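/- Let $\mathbb{F}_q$ be a finite field with $q$ elements, $K=\mathbb{F}_q(x)$ the rational function field, $\alpha\in\mathbb{F}_q$, $T=(x-\alpha)^{-1}$ (so that $K=\mathbb{F}_q(T)$), and let $n\ge 1$ be an integer. Let $\mathbb{F}_q[T]$ act on an algebraic closure $K^{ac}$ of $K$ by $z^{f(T)}=f(\varphi)(z)$, where $\varphi(z)=z^q+Tz$, let $\Lambda_{T^{n+1}}=\{z\in K^{ac} : z^{T^{n+1}}=0\}$, and let $K_n=K(\Lambda_{T^{n+1}})$ be the cyclotomic function field with modulus $T^{n+1}$. It is a finite abelian extension of $K$. For a finite abelian extension $E/K$, a place $P$ of $K$ and a place $Q$ of $E$ over $P$ with valuation ring $\mathcal{O}_Q$ and normalized valuation $\nu_Q$, let $e(Q|P)$ be the ramification index and $d(Q|P)$ the different exponent, let $G_i(Q|P)=\{\sigma\in\mathrm{Gal}(E/K) : \nu_Q(\sigma(z)-z)\ge i+1 \text{ for all } z\in\mathcal{O}_Q\}$, and let $a(Q|P)$ be the least integer $l\ge 0$ such that $G_i(Q|P)$ is trivial for all $i\ge l$. The conductor of $E/K$ is the divisor $$\mathrm{Cond}(E/K)=\sum_P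 c_P(E/K)\,P,\qquad c_P(E/K)=\frac{d(Q|P)+a(Q|P)}{e(Q|P)},$$ where $Q$ is any place of $E$ over $P$ (the value does not depend on the choice of $Q$). Let $\infty$ be the pole of $x$ and $P_\alpha$ the zero of $x-\alpha$ in $K$. Then $$\mathrm{Cond}(K_n/K)=(n+1)\cdot\infty+\min\{1,q-2\}\cdot P_\alpha .$$ Furthermore, let $F$ be the subfield of $K_n$ fixed by $\mathbb{F}_q^*$, that is, by the automorphisms $\sigma\in\mathrm{Gal}(K_n/K)$ for which there is an $a\in\mathbb{F}_q^*$ with $\sigma(\lambda)=a\lambda$ for all $\lambda\in\Lambda_{T^{n+1}}$. Then $F/K$ is finite abelian and $$\mathrm{Cond}(F/K)=(n+1)\cdot\infty .$$ -/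

import Mathlib

open Polynomial

noncomputable section

/-- A place of a field extension `E / k`, given by its valuation ring: a valuation ring of `E`
that contains `k` and is not all of `E`. -/
@[ext]
structure Place (k E : Type*) [Field k] [Field E] [Algebra k E] where
  /-- The valuation ring `𝒪_Q` of the place. -/
  ring : ValuationSubring E
  algebraMap_mem : ∀ c : k, algebraMap k E c ∈ ring
  ne_top : ring ≠ ⊤

namespace Place

section Extension

variable {k F E : Type*} [Field k] [Field F] [Field E] [Algebra k F] [Algebra k E] [Algebra F E]

/-- `Q` lies over `P`: the valuation ring of `P` is the intersection of that of `Q` with `F`. -/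
def LiesOver (Q : Place k E) (P : Place k F) : Prop :=
  P.ring = Q.ring.comap (algebraMap F E)

/-- The integral closure `𝒪'_P` in `E` of the valuation ring of the place `P` of `F`. -/
abbrev intClosure (P : Place k F) (E : Type*) [Field E] [Algebra F E] : Subalgebra P.ring E :=
  integralClosure P.ring E

theorem LiesOver.mem_ring {Q : Place k E} {P : Place k F} (h : Q.LiesOver P)
    (b : P.intClosure E) : (b : E) ∈ Q.ring := by
  obtain ⟨p, hp, hb⟩ := b.2
  have hr : ∀ r : P.ring, algebraMap P.ring E r ∈ Q.ring := fun r ↦ by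
    have hr : (r : F) ∈ Q.ring.comap (algebraMap F E) := h ▸ r.2
    exact hr
  have hint : IsIntegral Q.ring (b : E) := by
    refine ⟨p.map ((algebraMap P.ring E).codRestrict Q.ring hr), hp.map _, ?_⟩
    rw [Polynomial.eval₂_map]
    exact hb
  obtain ⟨y, hy⟩ := IsIntegrallyClosed.isIntegral_iff.mp hint
  exact hy ▸ y.2

/-- The inclusion of the integral closure of `𝒪_P` into `𝒪_Q`, for `Q` over `P`. -/
def LiesOver.incl {Q : Place k E} {P : Place k F} (h : Q.LiesOver P) :
    P.intClosure E →+* Q.ring :=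
  (P.intClosure E).val.toRingHom.codRestrict Q.ring h.mem_ring

/-- The maximal ideal of the integral closure of `𝒪_P` that corresponds to the place `Q` over
`P`, that is, the intersection of the integral closure with the maximal ideal of `𝒪_Q`. -/
def LiesOver.center {Q : Place k E} {P : Place k F} (h : Q.LiesOver P) :
    Ideal (P.intClosure E) :=
  (IsLocalRing.maximalIdeal Q.ring).comap h.incl

/-- The ramification index `e(Q|P)`. -/
def ramIndex {Q : Place k E} {P : Place k F} (h : Q.LiesOver P) : ℕ :=
  Ideal.ramificationIdx' (IsLocalRing.maximalIdeal P.ring) h.center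

/-- The different over `P`: the inverse in `𝒪'_P` of the complementary module
`{z ∈ E | Tr_{E/F}(z 𝒪'_P) ⊆ 𝒪_P}`. -/
def differentOver (P : Place k F) (E : Type*) [Field E] [Algebra F E] : Ideal (P.intClosure E) :=
  (1 / Submodule.traceDual P.ring F 1 : Submodule (P.intClosure E) E).comap
    (Algebra.linearMap (P.intClosure E) E)

/-- The different exponent `d(Q|P)`: the exponent of the prime of `𝒪'_P` corresponding to `Q` in
the different over `P`. -/
def diffExponent {Q : Place k E} {P : Place k F} (h : Q.LiesOver P) : ℕ :=
  multiplicity h.center (P.differentOver E)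

variable (F) in
/-- The `i`-th ramification group, `i ≥ 0`: the set of all `σ ∈ Gal(E/F)` with
`ν_Q(σ z - z) ≥ i + 1` for all `z ∈ 𝒪_Q`. As `𝒪_Q` is a discrete valuation ring, the inequality
says that `σ z - z` lies in the `(i+1)`-st power of the maximal ideal. -/
def ramGroup (Q : Place k E) (i : ℕ) : Set Gal(E/F) :=
  {σ | ∀ z : Q.ring, ∃ w ∈ IsLocalRing.maximalIdeal Q.ring ^ (i + 1), (w : E) = σ (z : E) - z}

variable (F) in
/-- `a(Q|P)`: the least integer `l ≥ 0` such that the `i`-th ramification group is trivial for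
all `i ≥ l`. -/
def ramBound (Q : Place k E) : ℕ :=
  sInf {l : ℕ | ∀ i, l ≤ i → Q.ramGroup F i = {1}}

/-- `(d(Q|P) + a(Q|P)) / e(Q|P)`. -/
def condExponent {Q : Place k E} {P : Place k F} (h : Q.LiesOver P) : ℚ :=
  ((diffExponent h : ℚ) + (Q.ramBound F : ℚ)) / (ramIndex h : ℚ)

end Extension

end Place

/-- The divisor `D` of `F / k` is the conductor of `E / F`: the extension `E / F` is finite abelian
and the coefficient of `D` at each place `P` is the conductor exponent `c_P(E/F)`, which is
computed at any of the places `Q` of `E` over `P`. -/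
structure IsConductor (k F E : Type*) [Field k] [Field F] [Field E] [Algebra k F] [Algebra k E]
    [Algebra F E] (D : Place k F →₀ ℤ) : Prop where
  finite : FiniteDimensional F E
  abelian : IsAbelianGalois F E
  exists_liesOver : ∀ P : Place k F, ∃ Q : Place k E, Q.LiesOver P
  coeff_eq : ∀ (P : Place k F) (Q : Place k E) (h : Q.LiesOver P),
    (D P : ℚ) = Place.condExponent h

section RationalFunctionField

variable (k : Type*) [Field k]

open scoped Classical in
/-- The place `∞` of the rational function field `k(x)`, the pole of `x`. -/
def placeInfty : Place k (RatFunc k) where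
  ring := (RatFunc.inftyValuation k).valuationSubring
  algebraMap_mem c := by
    rw [Valuation.mem_valuationSubring_iff, RatFunc.algebraMap_eq_C]
    by_cases hc : c = 0
    · simp [hc]
    · rw [RatFunc.inftyValuation.C k hc]
  ne_top h := by
    have hX : (RatFunc.X : RatFunc k) ∈ (RatFunc.inftyValuation k).valuationSubring :=
      h ▸ ValuationSubring.mem_top _
    rw [Valuation.mem_valuationSubring_iff, RatFunc.inftyValuation.X] at hX
    exact absurd hX (by decide)

variable {k} in
/-- The height one prime `(x - α)` of `k[x]`. -/
def primeXSubC (α : k) : IsDedekindDomain.HeightOneSpectrum k[X] where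
  asIdeal := Ideal.span {X - C α}
  isPrime := (Ideal.span_singleton_prime (X_sub_C_ne_zero α)).2 (prime_X_sub_C α)
  ne_bot := by simpa using X_sub_C_ne_zero α

variable {k} in
/-- The place `P_α` of the rational function field `k(x)`, the zero of `x - α`. -/
def placeZero (α : k) : Place k (RatFunc k) where
  ring := ((primeXSubC α).valuation (RatFunc k)).valuationSubring
  algebraMap_mem c := by
    rw [Valuation.mem_valuationSubring_iff, IsScalarTower.algebraMap_apply k k[X] (RatFunc k)]
    exact (primeXSubC α).valuation_le_one _
  ne_top h := by
    have hlt : (primeXSubC α).valuation (RatFunc k) (algebraMap k[X] (RatFunc k) (X - C α)) < 1 :=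
      ((primeXSubC α).valuation_lt_one_iff_mem _).2 (Ideal.mem_span_singleton_self _)
    have hmem : (algebraMap k[X] (RatFunc k) (X - C α))⁻¹ ∈
        ((primeXSubC α).valuation (RatFunc k)).valuationSubring := h ▸ ValuationSubring.mem_top _
    rw [Valuation.mem_valuationSubring_iff, map_inv₀] at hmem
    have hne : (primeXSubC α).valuation (RatFunc k) (algebraMap k[X] (RatFunc k) (X - C α)) ≠ 0 :=
      (Valuation.ne_zero_iff _).2
        (by simpa using (RatFunc.algebraMap_ne_zero (X_sub_C_ne_zero α)))
    exact absurd hmem (not_le.2 ((one_lt_inv₀ (zero_lt_iff.2 hne)).2 hlt))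

end RationalFunctionField

section Carlitz

variable {k : Type*} [Field k] [Fintype k]

/-- The endomorphism `φ(z) = z^q + T z` of an algebraic closure of `K = k(x)`, where `q = |k|`
and `T ∈ K`; it is `k`-linear. -/
def carlitzEnd (T : RatFunc k) : Module.End k (AlgebraicClosure (RatFunc k)) :=
  (FiniteField.frobeniusAlgHom k (AlgebraicClosure (RatFunc k))).toLinearMap +
    LinearMap.mulLeft k (algebraMap (RatFunc k) (AlgebraicClosure (RatFunc k)) T)

/-- The set `Λ_M` of `M`-torsion points, for a polynomial `M` in `T`: the zeros of
`z ↦ z^M = M(φ)(z)`. -/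
def carlitzTorsion (T : RatFunc k) (M : k[X]) : Set (AlgebraicClosure (RatFunc k)) :=
  {z | (aeval (carlitzEnd T) M) z = 0}

/-- The cyclotomic function field `K(Λ_M)` over `K = k(x) = k(T)` with modulus `M(T)`. -/
abbrev cyclotomicFunctionField (T : RatFunc k) (M : k[X]) :
    IntermediateField (RatFunc k) (AlgebraicClosure (RatFunc k)) :=
  IntermediateField.adjoin (RatFunc k) (carlitzTorsion T M)

/-- The image of `k^*` in `Gal(K(Λ_M)/K)`: the automorphisms `σ_a`, `a ∈ k^*`, that act on `Λ_M`
by `λ ↦ λ^a = a λ`. -/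
def constUnits (T : RatFunc k) (M : k[X]) :
    Subgroup Gal(cyclotomicFunctionField T M/RatFunc k) where
  carrier := {σ | ∃ a : kˣ, ∀ z : cyclotomicFunctionField T M,
    (z : AlgebraicClosure (RatFunc k)) ∈ carlitzTorsion T M → σ z = (a : k) • z}
  one_mem' := ⟨1, fun z _ ↦ by simp⟩
  mul_mem' := by
    rintro σ τ ⟨a, ha⟩ ⟨b, hb⟩
    refine ⟨a * b, fun z hz ↦ ?_⟩
    have hl : σ ((b : k) • z) = (b : k) • σ z :=
      LinearMap.map_smul_of_tower σ.toLinearMap (b : k) z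
    rw [AlgEquiv.mul_apply, hb z hz, hl, ha z hz, smul_smul, Units.val_mul, mul_comm]
  inv_mem' := by
    rintro σ ⟨a, ha⟩
    refine ⟨a⁻¹, fun z hz ↦ ?_⟩
    have hl : σ (((a⁻¹ : kˣ) : k) • z) = ((a⁻¹ : kˣ) : k) • σ z :=
      LinearMap.map_smul_of_tower σ.toLinearMap ((a⁻¹ : kˣ) : k) z
    have hz' : σ (((a⁻¹ : kˣ) : k) • z) = z := by
      rw [hl, ha z hz, smul_smul, Units.inv_mul, one_smul]
    exact (AlgEquiv.symm_apply_eq σ).2 hz'.symm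

/-- The subfield `F` of `K(Λ_M)` fixed by `k^*`. -/
abbrev constUnitsFixedField (T : RatFunc k) (M : k[X]) :
    IntermediateField (RatFunc k) (cyclotomicFunctionField T M) :=
  IntermediateField.fixedField (constUnits T M)

/-- The cyclotomic function field `K_n = K(Λ_{T^{n+1}})` for `T = (x - α)⁻¹`. -/
abbrev cyclotomicK (α : k) (n : ℕ) :
    IntermediateField (RatFunc k) (AlgebraicClosure (RatFunc k)) :=
  cyclotomicFunctionField (RatFunc.X - RatFunc.C α)⁻¹ (X ^ (n + 1))

/-- The subfield `F` of `K_n` fixed by `k^*`. -/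
abbrev cyclotomicF (α : k) (n : ℕ) : IntermediateField (RatFunc k) (cyclotomicK α n) :=
  constUnitsFixedField (RatFunc.X - RatFunc.C α)⁻¹ (X ^ (n + 1))

end Carlitz

end

/-!
Let `q = |k|`, `φ(z) = z^q + T z`, and let `x` be a generator of the `T^{n+1}`-torsion, that is,
`φ^n(x)^{q-1} = -T`. Then `K_n = K(x)`, and `σ x - x` is a nonzero torsion point for `σ ≠ 1`.

* At `∞` the function `T` is a uniformizer and the polynomial `Φ` given by
  `φ^{n+1}(X) = φ^n(X) Φ(X)` is Eisenstein with root `x`. So the place is totally ramified and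
  `𝒪_Q = 𝒪_P[x]`, which gives `d = ν(Φ'(x))`, while `a` is the largest value `ν(σ x - x)`, attained
  for `σ₀ x = x + φ^n(x)`. Differentiating the factorization at `x` gives
  `T^{n+1} = φ^n(x) Φ'(x) = (σ₀ x - x) Φ'(x)`, whence `d + a = (n + 1) e`.
* At `P_α` the function `T` has a pole. Every nonzero `T^n`-torsion point is `φ(y)` for a strictly
  smaller torsion point `y`, so a nonzero torsion point `x` of least absolute value is a generator
  and strictly smaller than all nonzero `T^n`-torsion points. For `σ` in the decomposition group,
  `σ x - c x` is killed by `T^n` for some `c ∈ k` and is not larger than `x`, hence it is zero. So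
  the decomposition group lies in `k^*`. As `φ^n(x)^{q-1} = -T`, the ramification index is divisible
  by `q - 1`; thus the place is tame with `e = q - 1`, `d = q - 2`, and `a = 1` unless `q = 2`.
* At the other places `σ x - x` is a unit for `σ ≠ 1`, so they are unramified.

The field `F` is generated by `y = x^{q-1}`, a root of the Eisenstein polynomial `Ψ` with
`Φ(X) = Ψ(X^{q-1})`, and the argument at `∞` carries over; at `P_α` the decomposition group becomes
trivial because it lies in the image of `k^*`.
-/

noncomputable section

open IsDedekindDomain WithZero

/-! ### Galois groups and Eisenstein polynomials over Dedekind domains -/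

section DecompositionGroup

open scoped Pointwise

attribute [local instance] FractionRing.liftAlgebra FractionRing.isScalarTower_liftAlgebra

variable {A B G : Type*} [CommRing A] [CommRing B] [Algebra A B] [Group G] [MulSemiringAction G B]

theorem smul_mem_iff_of_mem_stabilizer {𝔓 : Ideal B} {σ : G}
    (hσ : σ ∈ MulAction.stabilizer G 𝔓) (b : B) : σ • b ∈ 𝔓 ↔ b ∈ 𝔓 := by
  conv_lhs => rw [← MulAction.mem_stabilizer_iff.1 hσ]
  exact Ideal.smul_mem_pointwise_smul_iff

theorem smul_mem_pow_iff_of_mem_stabilizer {𝔓 : Ideal B} {σ : G}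
    (hσ : σ ∈ MulAction.stabilizer G 𝔓) (i : ℕ) (b : B) : σ • b ∈ 𝔓 ^ i ↔ b ∈ 𝔓 ^ i :=
  smul_mem_iff_of_mem_stabilizer
    (by rw [MulAction.mem_stabilizer_iff, smul_pow', MulAction.mem_stabilizer_iff.1 hσ]) b

theorem natCard_stabilizer_eq_ramificationIdx_mul_inertiaDeg [Finite G] [IsDomain A]
    [IsDedekindDomain B] [Module.IsTorsionFree A B] [Module.Finite A B] [Module.Flat A B]
    [IsGaloisGroup G A B] (p : Ideal A) [p.IsPrime] (hp : p ≠ ⊥) (𝔓 : Ideal B) [𝔓.IsPrime]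
    [𝔓.LiesOver p] :
    Nat.card (MulAction.stabilizer G 𝔓) = Ideal.ramificationIdx' p 𝔓 * 𝔓.inertiaDeg A := by
  have orbit_finite : (MulAction.orbit G 𝔓).Finite := Set.finite_range _
  refine mul_left_cancel₀
    ((Set.ncard_pos orbit_finite).2 ⟨_, MulAction.mem_orbit_self (M := G) 𝔓⟩).ne' ?_
  calc (MulAction.orbit G 𝔓).ncard * Nat.card (MulAction.stabilizer G 𝔓) = Nat.card G := by
        rw [← Nat.card_coe_set_eq, ← Nat.card_prod,
          Nat.card_congr (MulAction.orbitProdStabilizerEquivGroup G 𝔓)]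
    _ = (p.primesOver B).ncard * (p.ramificationIdxIn B * p.inertiaDegIn B) :=
        (Ideal.ncard_primesOver_mul_ramificationIdxIn_mul_inertiaDegIn p B G).symm
    _ = _ := by
        rw [Ideal.ramificationIdxIn_eq_ramificationIdx p 𝔓 G,
          Ideal.inertiaDegIn_eq_inertiaDeg p 𝔓 G,
          ← Ideal.ramificationIdx'_eq_ramificationIdx p 𝔓 hp,
          ← Algebra.IsInvariant.orbit_eq_primesOver A B G p 𝔓]

theorem natCard_stabilizer_le_inertiaDeg_of_inertia_eq_bot [SMulCommClass G A B]
    [Module.Finite A B] (p : Ideal A) [p.IsMaximal] (𝔓 : Ideal B) [𝔓.IsMaximal] [𝔓.LiesOver p]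
    (h𝔓 : 𝔓.inertia G = ⊥) : Nat.card (MulAction.stabilizer G 𝔓) ≤ 𝔓.inertiaDeg A := by
  let _ : Field (A ⧸ p) := Ideal.Quotient.field _
  let _ : Field (B ⧸ 𝔓) := Ideal.Quotient.field _
  have stabilizerHom_injective : Function.Injective (Ideal.Quotient.stabilizerHom 𝔓 p G) := by
    rw [← MonoidHom.ker_eq_bot_iff,
      ← Subgroup.map_eq_bot_iff_of_injective _ (Subgroup.subtype_injective _),
      Ideal.Quotient.map_ker_stabilizer_subtype, h𝔓]
  rw [Ideal.inertiaDeg_eq_of_isMaximal p]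
  exact (Nat.card_le_card_of_injective _ stabilizerHom_injective).trans
    (Nat.card_eq_fintype_card.trans_le AlgEquiv.card_le)

theorem exists_sum_stabilizer_smul_notMem_of_inertia_eq_bot (𝔓 : Ideal B) [𝔓.IsMaximal]
    [Fintype (MulAction.stabilizer G 𝔓)] (h𝔓 : 𝔓.inertia G = ⊥) :
    ∃ y : B, ∑ σ : MulAction.stabilizer G 𝔓, σ • y ∉ 𝔓 := by
  let _ : Field (B ⧸ 𝔓) := Ideal.Quotient.field _
  let residue (σ : MulAction.stabilizer G 𝔓) : B →* B ⧸ 𝔓 :=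
    (Ideal.Quotient.mk 𝔓 : B →* B ⧸ 𝔓).comp (MulDistribMulAction.toMonoidHom B σ)
  have residue_injective : Function.Injective residue := by
    intro σ τ hστ
    have hmem : (τ⁻¹ * σ : MulAction.stabilizer G 𝔓).1 ∈ 𝔓.inertia G := by
      intro x
      have hx : σ • x - τ • x ∈ 𝔓 := Ideal.Quotient.eq.1 (DFunLike.congr_fun hστ x)
      refine (smul_mem_iff_of_mem_stabilizer τ.2 _).1 ?_
      convert hx using 1
      rw [smul_sub, smul_smul, Subgroup.coe_mul, Subgroup.coe_inv, mul_inv_cancel_left]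
      rfl
    rw [h𝔓, Subgroup.mem_bot, OneMemClass.coe_eq_one, inv_mul_eq_one] at hmem
    exact hmem.symm
  have independent := (linearIndependent_monoidHom B (B ⧸ 𝔓)).comp residue residue_injective
  by_contra! hmem
  refine one_ne_zero (Fintype.linearIndependent_iff.1 independent (fun _ ↦ 1) ?_ 1)
  funext y
  simpa [residue, ← map_sum] using Ideal.Quotient.eq_zero_iff_mem.2 (hmem y)

theorem smul_mem_of_notMem_stabilizer [SMulCommClass G A B] (p : Ideal A) (𝔓 I : Ideal B)
    [𝔓.IsMaximal] [𝔓.LiesOver p] {e : ℕ} (hI : p.map (algebraMap A B) = 𝔓 ^ e * I) {x : B}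
    (hx : x ∈ I) {σ : G} (hσ : σ ∉ MulAction.stabilizer G 𝔓) : σ • x ∈ 𝔓 := by
  have isPrime_smul : (σ⁻¹ • 𝔓).IsPrime := inferInstance
  have mul_le : 𝔓 ^ e * I ≤ σ⁻¹ • 𝔓 := by
    rw [← hI, Ideal.map_le_iff_le_comap, ← Ideal.under_def, ← Ideal.over_def (σ⁻¹ • 𝔓) p]
  rcases isPrime_smul.mul_le.1 mul_le with hle | hle
  · have h𝔓 : 𝔓 = σ⁻¹ • 𝔓 :=
      Ideal.IsMaximal.eq_of_le ‹_› isPrime_smul.ne_top (isPrime_smul.le_of_pow_le hle)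
    exact absurd (MulAction.mem_stabilizer_iff.2 (eq_inv_smul_iff.1 h𝔓)) hσ
  · simpa [Ideal.mem_inv_pointwise_smul_iff] using hle hx

theorem sum_smul_mul_sub_sum_stabilizer_smul_mem [SMulCommClass G A B] [Fintype G]
    (p : Ideal A) (𝔓 I : Ideal B) [𝔓.IsMaximal] [𝔓.LiesOver p]
    [Fintype (MulAction.stabilizer G 𝔓)] {e : ℕ}
    (hI : p.map (algebraMap A B) = 𝔓 ^ e * I) {x : B} (hx : x ∈ I) (hx1 : x - 1 ∈ 𝔓) (y : B) :
    ∑ σ : G, σ • (x * y) - ∑ σ : MulAction.stabilizer G 𝔓, σ • y ∈ 𝔓 := by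
  classical
  have sum_stabilizer : ∑ σ : MulAction.stabilizer G 𝔓, σ • y =
      ∑ σ : G, if σ ∈ MulAction.stabilizer G 𝔓 then σ • y else 0 := by
    rw [← Finset.sum_filter]
    exact (Finset.sum_subtype _ (by simp) fun σ : G ↦ σ • y).symm
  rw [sum_stabilizer, ← Finset.sum_sub_distrib]
  refine sum_mem fun σ _ ↦ ?_
  split_ifs with hσ
  · have smul_eq : σ • (x * y) - σ • y = σ • (x - 1) * σ • y := by
      rw [smul_mul', smul_sub, smul_one]
      ring
    rw [smul_eq]
    exact 𝔓.mul_mem_right _ ((smul_mem_iff_of_mem_stabilizer hσ _).2 hx1)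
  · rw [sub_zero]
    exact smul_mem_of_notMem_stabilizer p 𝔓 I hI (I.mul_mem_right y hx) hσ

theorem not_pow_dvd_differentIdeal_of_sum_stabilizer_smul_notMem [Fintype G]
    [IsDedekindDomain A] [IsDedekindDomain B] [Module.IsTorsionFree A B] [Module.Finite A B]
    [SMulCommClass G A B] [Algebra.IsSeparable (FractionRing A) (FractionRing B)]
    (htrace : ∀ x : B, algebraMap A B (Algebra.intTrace A B x) = ∑ σ : G, σ • x)
    (p : Ideal A) (𝔓 I : Ideal B) [h𝔓 : 𝔓.IsMaximal] [𝔓.LiesOver p]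
    [Fintype (MulAction.stabilizer G 𝔓)] {e : ℕ}
    (hI : p.map (algebraMap A B) = 𝔓 ^ e * I) (hnle : ¬ I ≤ 𝔓) {y : B}
    (hy : ∑ σ : MulAction.stabilizer G 𝔓, σ • y ∉ 𝔓) : ¬ 𝔓 ^ e ∣ differentIdeal A B := by
  obtain ⟨x, hxI, hx1⟩ : ∃ x ∈ I, x - 1 ∈ 𝔓 := by
    have sup_eq_top : I ⊔ 𝔓 = ⊤ := (sup_comm I 𝔓).trans (h𝔓.1.2 _ (left_lt_sup.2 hnle))
    obtain ⟨x, hx, c, hc, hxc⟩ := Submodule.mem_sup.1 ((Ideal.eq_top_iff_one _).1 sup_eq_top)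
    exact ⟨x, hx, by rw [← hxc, sub_add_cancel_left]; exact neg_mem hc⟩
  refine not_dvd_differentIdeal_of_intTrace_not_mem A _ I hI.symm (x * y) (I.mul_mem_right y hxI)
    fun trace_mem ↦ hy ?_
  have sum_mem : ∑ σ : G, σ • (x * y) ∈ 𝔓 := by
    rwa [← htrace, ← Ideal.mem_comap, ← Ideal.under_def, ← Ideal.over_def 𝔓 p]
  rw [← sub_sub_cancel (∑ σ : G, σ • (x * y)) (∑ σ : MulAction.stabilizer G 𝔓, σ • y)]
  exact Submodule.sub_mem _ sum_mem (sum_smul_mul_sub_sum_stabilizer_smul_mem p 𝔓 I hI hxI hx1 y)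

end DecompositionGroup

section Eisenstein

variable {A K L : Type*} [CommRing A] [IsDomain A] [Field K] [Field L] [Algebra A K]
  [IsFractionRing A K] [Algebra K L] [Algebra A L] [IsScalarTower A K L]

theorem minpoly_eq_map_of_isEisensteinAt [IsIntegrallyClosed A] {p : Ideal A} (hp : p.IsPrime)
    {g : A[X]} (hg : g.Monic) (hE : g.IsEisensteinAt p) (hdeg : 0 < g.natDegree) {x : L}
    (hx : aeval x g = 0) : minpoly K x = g.map (algebraMap A K) := by
  have irreducible_map := (hg.irreducible_iff_irreducible_map_fraction_map (K := K)).1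
    (hE.irreducible hp hg.isPrimitive hdeg)
  refine (minpoly.eq_of_irreducible_of_monic irreducible_map ?_ (hg.map _)).symm
  rwa [aeval_map_algebraMap]

theorem exists_pow_smul_mem_adjoin [IsDiscreteValuationRing A] {t : A} (ht : Irreducible t) {x : L}
    (hgen : Algebra.adjoin K {x} = ⊤) (z : L) : ∃ n : ℕ, t ^ n • z ∈ Algebra.adjoin A {x} := by
  obtain ⟨f, rfl⟩ : ∃ f : K[X], aeval x f = z := by
    have hz : z ∈ Algebra.adjoin K {x} := hgen ▸ Algebra.mem_top
    rwa [Algebra.adjoin_singleton_eq_range_aeval] at hz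
  obtain ⟨b, hb0, hb⟩ := IsLocalization.integerNormalization_spec (nonZeroDivisors A) f
  obtain ⟨n, u, hu⟩ := IsDiscreteValuationRing.eq_unit_mul_pow_irreducible
    (nonZeroDivisors.ne_zero hb0) ht
  have smul_aeval_mem : b • aeval x f ∈ Algebra.adjoin A {x} := by
    have smul_aeval : aeval x (b • f) = b • aeval x f :=
      map_smul ((aeval x : K[X] →ₐ[K] L).restrictScalars A) b f
    rw [← smul_aeval, ← hb, aeval_map_algebraMap]
    exact aeval_mem_adjoin_singleton A x
  refine ⟨n, ?_⟩
  have pow_eq : t ^ n = ((u⁻¹ : Aˣ) : A) * b := by rw [hu, ← mul_assoc, Units.inv_mul, one_mul]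
  rw [pow_eq, mul_smul]
  exact Subalgebra.smul_mem _ smul_aeval_mem _

theorem mem_adjoin_of_isEisensteinAt_of_isIntegral [IsDiscreteValuationRing A]
    {g : A[X]} (hg : g.Monic) (hE : g.IsEisensteinAt (IsLocalRing.maximalIdeal A))
    (hdeg : 0 < g.natDegree) {x : L} (hx : aeval x g = 0) (hgen : Algebra.adjoin K {x} = ⊤) {z : L}
    (hz : IsIntegral A z) : z ∈ Algebra.adjoin A {x} := by
  have minpoly_eq : minpoly A x = g := by
    have map_eq := minpoly_eq_map_of_isEisensteinAt (K := K)
      (Ideal.IsMaximal.isPrime inferInstance) hg hE hdeg hx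
    rw [minpoly.isIntegrallyClosed_eq_field_fractions' K ⟨g, hg, hx⟩] at map_eq
    exact map_injective _ (IsFractionRing.injective A K) map_eq
  have hxA : IsIntegral A x := ⟨g, hg, hx⟩
  have hxK : IsIntegral K x := hxA.tower_top
  let B : PowerBasis K L := PowerBasis.ofAdjoinEqTop hxK hgen
  have gen_eq : B.gen = x := PowerBasis.ofAdjoinEqTop_gen hxK hgen
  obtain ⟨t, ht⟩ := IsDiscreteValuationRing.exists_irreducible A
  obtain ⟨n, hn⟩ := exists_pow_smul_mem_adjoin ht hgen z
  rw [ht.maximalIdeal_eq, ← minpoly_eq] at hE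
  rw [← gen_eq] at hE hxA hn ⊢
  exact mem_adjoin_of_smul_prime_pow_smul_of_minpoly_isEisensteinAt ht.prime hxA hz hn hE

end Eisenstein

theorem lt_one_iff_le_exp_neg_one (x : ℤᵐ⁰) : x < 1 ↔ x ≤ exp (-1) := by
  by_cases hx : x = 0
  · simp [hx]
  · rw [← exp_zero, ← log_lt_iff_lt_exp hx, ← log_le_iff_le_exp hx]
    lia

theorem exists_eq_exp_neg_natCast {x : ℤᵐ⁰} (hx : x ≠ 0) (hx1 : x ≤ 1) :
    ∃ m : ℕ, x = exp (-(m : ℤ)) := by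
  rw [← exp_zero, ← log_le_iff_le_exp hx] at hx1
  exact ⟨(-log x).toNat, by rw [Int.toNat_of_nonneg (by lia), neg_neg, exp_log hx]⟩

/-! ### The discrete valuation of a place -/

namespace Place

section IntClosure

variable {k F : Type*} [Field k] [Field F] [Algebra k F] (P : Place k F)
  (E : Type*) [Field E] [Algebra F E]

theorem isDedekindDomain_intClosure [IsDiscreteValuationRing P.ring] [FiniteDimensional F E]
    [Algebra.IsSeparable F E] : IsDedekindDomain (P.intClosure E) :=
  integralClosure.isDedekindDomain P.ring F E

theorem finite_intClosure [IsDiscreteValuationRing P.ring] [FiniteDimensional F E]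
    [Algebra.IsSeparable F E] : Module.Finite P.ring (P.intClosure E) :=
  IsIntegralClosure.finite P.ring F E (P.intClosure E)

theorem isFractionRing_intClosure [FiniteDimensional F E] : IsFractionRing (P.intClosure E) E :=
  IsIntegralClosure.isFractionRing_of_finite_extension P.ring F E (P.intClosure E)

theorem faithfulSMul_intClosure : FaithfulSMul P.ring (P.intClosure E) :=
  (faithfulSMul_iff_algebraMap_injective _ _).2 fun _ _ hab ↦
    Subtype.ext ((algebraMap F E).injective (congrArg Subtype.val hab))

end IntClosure

section Center

variable {k F E : Type*} [Field k] [Field F] [Field E] [Algebra k F] [Algebra k E] [Algebra F E]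
  {P : Place k F} {Q : Place k E}

theorem LiesOver.algebraMap_mem_iff (h : Q.LiesOver P) (x : F) :
    algebraMap F E x ∈ Q.ring ↔ x ∈ P.ring := by
  rw [show P.ring = _ from h, ValuationSubring.mem_comap]

theorem LiesOver.mem_center_iff (h : Q.LiesOver P) (b : P.intClosure E) :
    b ∈ h.center ↔ (b : E) ∈ Q.ring.nonunits :=
  (ValuationSubring.coe_mem_nonunits_iff (a := h.incl b)).symm

instance LiesOver.isPrime_center (h : Q.LiesOver P) : h.center.IsPrime :=
  Ideal.comap_isPrime _ _

instance LiesOver.liesOver_center (h : Q.LiesOver P) :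
    h.center.LiesOver (IsLocalRing.maximalIdeal P.ring) := by
  constructor
  ext t
  have coe_algebraMap : (algebraMap P.ring (P.intClosure E) t : E) = algebraMap F E t := rfl
  rw [Ideal.under, Ideal.mem_comap, h.mem_center_iff, coe_algebraMap,
    ← ValuationSubring.coe_mem_nonunits_iff, ValuationSubring.mem_nonunits_iff_or,
    ValuationSubring.mem_nonunits_iff_or, ← map_inv₀, h.algebraMap_mem_iff, map_eq_zero]

theorem LiesOver.inv_mem_of_notMem_center (h : Q.LiesOver P) {s : P.intClosure E}
    (hs : s ∉ h.center) : (s : E)⁻¹ ∈ Q.ring := by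
  rw [h.mem_center_iff, ValuationSubring.mem_nonunits_iff_or] at hs
  tauto

theorem LiesOver.coe_ne_zero_of_notMem_center (h : Q.LiesOver P) {s : P.intClosure E}
    (hs : s ∉ h.center) : (s : E) ≠ 0 :=
  fun h0 ↦ hs (ZeroMemClass.coe_eq_zero.1 h0 ▸ zero_mem _)

end Center

attribute [local instance] FractionRing.liftAlgebra FractionRing.isScalarTower_liftAlgebra
  faithfulSMul_intClosure isDedekindDomain_intClosure finite_intClosure isFractionRing_intClosure

section Valuation

variable {k F E : Type*} [Field k] [Field F] [Field E] [Algebra k F] [Algebra k E] [Algebra F E]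
  {P : Place k F} {Q : Place k E} [IsDiscreteValuationRing P.ring]

theorem LiesOver.center_ne_bot (h : Q.LiesOver P) : h.center ≠ ⊥ :=
  Ideal.ne_bot_of_liesOver_of_ne_bot (IsDiscreteValuationRing.not_a_field P.ring) h.center

variable [FiniteDimensional F E] [Algebra.IsSeparable F E]

/-- The height one prime of the integral closure `𝒪'_P` that corresponds to `Q`. -/
def LiesOver.prime (h : Q.LiesOver P) : HeightOneSpectrum (P.intClosure E) :=
  ⟨h.center, h.isPrime_center, h.center_ne_bot⟩

/-- The normalized valuation `ν_Q`, written multiplicatively: `h.val z = exp (-ν_Q(z))`. -/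
def LiesOver.val (h : Q.LiesOver P) : Valuation E ℤᵐ⁰ :=
  h.prime.valuation E

theorem LiesOver.val_coe_le_one (h : Q.LiesOver P) (b : P.intClosure E) : h.val (b : E) ≤ 1 :=
  h.prime.valuation_le_one b

theorem LiesOver.val_coe_lt_one_iff (h : Q.LiesOver P) (b : P.intClosure E) :
    h.val (b : E) < 1 ↔ b ∈ h.center :=
  h.prime.valuation_lt_one_iff_mem b

theorem LiesOver.val_coe_eq_one_iff (h : Q.LiesOver P) (b : P.intClosure E) :
    h.val (b : E) = 1 ↔ b ∉ h.center := by
  rw [← h.val_coe_lt_one_iff, not_lt, (h.val_coe_le_one b).ge_iff_eq', eq_comm]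

theorem LiesOver.val_coe_le_exp_iff (h : Q.LiesOver P) (b : P.intClosure E) (i : ℕ) :
    h.val (b : E) ≤ exp (-(i : ℤ)) ↔ b ∈ h.center ^ i := by
  have hint := h.prime.intValuation_le_pow_iff_mem b i
  rwa [← h.prime.valuation_of_algebraMap (K := E) b] at hint

theorem LiesOver.exists_mul_eq_coe (h : Q.LiesOver P) {x : E} (hx : h.val x ≤ 1) :
    ∃ b s : P.intClosure E, s ∉ h.center ∧ x * s = b := by
  obtain ⟨b, s, hs⟩ := h.prime.exists_primeCompl_mul_eq_of_integer x hx
  exact ⟨b, s, s.2, hs⟩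

theorem LiesOver.mem_ring_of_val_le_one (h : Q.LiesOver P) {x : E} (hx : h.val x ≤ 1) :
    x ∈ Q.ring := by
  obtain ⟨b, s, hs, hbs⟩ := h.exists_mul_eq_coe hx
  have hs0 := h.coe_ne_zero_of_notMem_center hs
  rw [← mul_inv_cancel_right₀ hs0 x, hbs]
  exact mul_mem (h.mem_ring b) (h.inv_mem_of_notMem_center hs)

theorem LiesOver.val_le_one_of_mem_ring (h : Q.LiesOver P) {x : E} (hx : x ∈ Q.ring) :
    h.val x ≤ 1 := by
  by_contra! hlt
  have hx0 : x ≠ 0 := by rintro rfl; simp at hlt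
  have hinv : h.val x⁻¹ < 1 := by rw [map_inv₀]; exact inv_lt_one_of_one_lt₀ hlt
  obtain ⟨b, s, hs, hbs⟩ := h.exists_mul_eq_coe hinv.le
  have hs0 := h.coe_ne_zero_of_notMem_center hs
  have hb : b ∈ h.center := by
    rwa [← h.val_coe_lt_one_iff, ← hbs, map_mul, (h.val_coe_eq_one_iff s).2 hs, mul_one]
  rw [h.mem_center_iff, ValuationSubring.mem_nonunits_iff_or, ← hbs] at hb
  refine hb.resolve_left (mul_ne_zero (inv_ne_zero hx0) hs0) ?_
  rw [mul_inv, inv_inv]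
  exact mul_mem hx (h.inv_mem_of_notMem_center hs)

theorem LiesOver.mem_ring_iff (h : Q.LiesOver P) (x : E) : x ∈ Q.ring ↔ h.val x ≤ 1 :=
  ⟨h.val_le_one_of_mem_ring, h.mem_ring_of_val_le_one⟩

theorem LiesOver.integers_val (h : Q.LiesOver P) : h.val.Integers Q.ring where
  hom_inj := Subtype.val_injective
  map_le_one x := (h.mem_ring_iff x).1 x.2
  exists_of_le_one x hx := ⟨⟨x, (h.mem_ring_iff x).2 hx⟩, rfl⟩

theorem LiesOver.mem_maximalIdeal_pow_iff (h : Q.LiesOver P) (z : Q.ring) (i : ℕ) :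
    z ∈ IsLocalRing.maximalIdeal Q.ring ^ i ↔ h.val (z : E) ≤ exp (-(i : ℤ)) := by
  obtain ⟨x, hx⟩ := h.prime.valuation_exists_uniformizer E
  obtain ⟨ϖ, rfl⟩ := h.integers_val.exists_of_le_one (hx.trans_le (by decide))
  have mem_span_iff (y w : Q.ring) : y ∈ Ideal.span {w} ↔ h.val (y : E) ≤ h.val (w : E) :=
    Ideal.mem_span_singleton.trans h.integers_val.dvd_iff_le
  have hmax : IsLocalRing.maximalIdeal Q.ring = Ideal.span {ϖ} := by
    ext y
    rw [mem_span_iff, IsLocalRing.mem_maximalIdeal, mem_nonunits_iff,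
      h.integers_val.isUnit_iff_valuation_eq_one, ← Ne, ← (h.integers_val.map_le_one y).lt_iff_ne,
      lt_one_iff_le_exp_neg_one, ← hx]
    rfl
  have hϖ : h.val ((ϖ ^ i : Q.ring) : E) = exp (-(i : ℤ)) := by
    rw [SubmonoidClass.coe_pow, map_pow, show h.val (ϖ : E) = _ from hx, ← exp_nsmul]
    simp
  rw [hmax, Ideal.span_singleton_pow, mem_span_iff, hϖ]

theorem LiesOver.val_algebraMap_uniformizer (h : Q.LiesOver P) {t : P.ring}
    (ht : IsLocalRing.maximalIdeal P.ring = Ideal.span {t}) :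
    h.val (algebraMap F E t) = exp (-(ramIndex h : ℤ)) := by
  have ht0 : (t : F) ≠ 0 := fun h0 ↦ IsDiscreteValuationRing.not_a_field P.ring
    (ht.trans (Ideal.span_singleton_eq_bot.2 (Subtype.ext h0)))
  have coe_t : ((algebraMap P.ring (P.intClosure E) t : P.intClosure E) : E) =
    algebraMap F E t := rfl
  obtain ⟨e, he⟩ := exists_eq_exp_neg_natCast (x := h.val (algebraMap F E t)) (by simpa using ht0)
    (coe_t ▸ h.val_coe_le_one _)
  have map_le_pow_iff (i : ℕ) : (IsLocalRing.maximalIdeal P.ring).map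
      (algebraMap P.ring (P.intClosure E)) ≤ h.center ^ i ↔ i ≤ e := by
    rw [ht, Ideal.map_span, Set.image_singleton, Ideal.span_singleton_le_iff_mem,
      ← h.val_coe_le_exp_iff, coe_t, he, exp_le_exp]
    lia
  rw [he, ramIndex, Ideal.ramificationIdx'_spec ((map_le_pow_iff e).2 le_rfl)
    (by rw [map_le_pow_iff]; lia)]

theorem LiesOver.ramIndex_ne_zero (h : Q.LiesOver P) : ramIndex h ≠ 0 := by
  obtain ⟨t, ht⟩ := (IsPrincipalIdealRing.principal (IsLocalRing.maximalIdeal P.ring)).principal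
  intro h0
  have hval := h.val_algebraMap_uniformizer ht
  rw [h0] at hval
  refine (h.val_coe_eq_one_iff (algebraMap P.ring (P.intClosure E) t)).1 (hval.trans (by simp)) ?_
  rw [← Ideal.mem_comap, ← Ideal.under_def,
    ← Ideal.over_def h.center (IsLocalRing.maximalIdeal P.ring), ht]
  exact Ideal.mem_span_singleton_self t

end Valuation

section Different

variable {k F : Type*} [Field k] [Field F] [Algebra k F] (P : Place k F)
  (E : Type*) [Field E] [Algebra F E] [FiniteDimensional F E] [Algebra.IsSeparable F E]

theorem isSeparable_fractionRing_intClosure :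
    Algebra.IsSeparable (FractionRing P.ring) (FractionRing (P.intClosure E)) := by
  refine Algebra.IsSeparable.of_equiv_equiv (FractionRing.algEquiv P.ring F).symm.toRingEquiv
    (FractionRing.algEquiv (P.intClosure E) E).symm.toRingEquiv ?_
  apply IsLocalization.ringHom_ext (nonZeroDivisors P.ring)
  ext a
  simp only [RingHom.coe_comp, RingHom.coe_coe, AlgEquiv.coe_ringEquiv, Function.comp_apply,
    AlgEquiv.commutes, ← IsScalarTower.algebraMap_apply]
  rw [IsScalarTower.algebraMap_apply P.ring (P.intClosure E) E, AlgEquiv.commutes,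
    ← IsScalarTower.algebraMap_apply]

attribute [local instance] isSeparable_fractionRing_intClosure

variable [IsDiscreteValuationRing P.ring]

theorem differentOver_eq : P.differentOver E = differentIdeal P.ring (P.intClosure E) := by
  rw [differentOver, ← coeSubmodule_differentIdeal P.ring F, IsLocalization.coeSubmodule,
    Submodule.comap_map_eq_of_injective]
  exact IsFractionRing.injective (P.intClosure E) E

theorem differentOver_ne_bot : P.differentOver E ≠ ⊥ := by
  rw [differentOver_eq]
  exact differentIdeal_ne_bot

variable {P E}

theorem differentOver_eq_span {π : P.intClosure E}
    (hadj : Algebra.adjoin P.ring {π} = ⊤) (hgen : Algebra.adjoin F {(π : E)} = ⊤) :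
    P.differentOver E = Ideal.span {aeval π (derivative (minpoly P.ring π))} := by
  have conductor_mul := conductor_mul_differentIdeal P.ring F E π hgen
  rw [conductor_eq_top_of_adjoin_eq_top hadj, Ideal.top_mul] at conductor_mul
  rw [differentOver_eq, conductor_mul]

end Different

theorem coe_aeval_derivative_minpoly {k F E : Type*} [Field k] [Field F] [Field E] [Algebra k F]
    [Algebra F E] {P : Place k F} (π : P.intClosure E) :
    ((aeval π (derivative (minpoly P.ring π)) : P.intClosure E) : E) =
      aeval (π : E) (derivative (minpoly F (π : E))) := by
  have minpoly_coe : minpoly F (π : E) = (minpoly P.ring π).map (algebraMap P.ring F) :=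
    minpoly.isIntegrallyClosed_eq_field_fractions F E (Algebra.IsIntegral.isIntegral π)
  rw [minpoly_coe, derivative_map, aeval_map_algebraMap]
  exact (aeval_algebraMap_apply E π _).symm

section RamificationGroups

variable {k F E : Type*} [Field k] [Field F] [Field E] [Algebra k E] [Algebra F E] {Q : Place k E}

theorem ramGroup_antitone : Antitone (Q.ramGroup F) := fun i j hij σ hσ z ↦ by
  obtain ⟨w, hw, hwz⟩ := hσ z
  exact ⟨w, Ideal.pow_le_pow_right (Nat.add_le_add_right hij 1) hw, hwz⟩

theorem one_mem_ramGroup (i : ℕ) : (1 : Gal(E/F)) ∈ Q.ramGroup F i :=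
  fun _ ↦ ⟨0, zero_mem _, by simp⟩

theorem ramGroup_eq_singleton_of_le {l : ℕ} (hl : ∀ σ ∈ Q.ramGroup F l, σ = 1) {i : ℕ}
    (hi : l ≤ i) : Q.ramGroup F i = {1} :=
  Set.eq_singleton_iff_unique_mem.2 ⟨one_mem_ramGroup i, fun σ hσ ↦ hl σ (ramGroup_antitone hi hσ)⟩

theorem ramBound_eq_zero (h0 : ∀ σ ∈ Q.ramGroup F 0, σ = 1) : Q.ramBound F = 0 :=
  Nat.sInf_eq_zero.2 (Or.inl fun _ hi ↦ ramGroup_eq_singleton_of_le h0 hi)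

theorem ramBound_eq_succ (m : ℕ) (hsucc : ∀ σ ∈ Q.ramGroup F (m + 1), σ = 1)
    (hm : ∃ σ ∈ Q.ramGroup F m, σ ≠ 1) : Q.ramBound F = m + 1 := by
  have mem_succ : m + 1 ∈ {l : ℕ | ∀ i, l ≤ i → Q.ramGroup F i = {1}} :=
    fun _ hi ↦ ramGroup_eq_singleton_of_le hsucc hi
  refine le_antisymm (Nat.sInf_le mem_succ) ?_
  by_contra! hlt
  obtain ⟨σ, hσ, hσ1⟩ := hm
  rw [Nat.sInf_mem ⟨_, mem_succ⟩ m (Nat.lt_succ_iff.1 hlt)] at hσ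
  exact hσ1 hσ

end RamificationGroups

section Monogenic

variable {k F E : Type*} [Field k] [Field F] [Field E] [Algebra k F] [Algebra k E] [Algebra F E]
  {P : Place k F} {Q : Place k E} [IsDiscreteValuationRing P.ring] [FiniteDimensional F E]
  [Algebra.IsSeparable F E]

theorem LiesOver.val_eq_exp_neg_diffExponent (h : Q.LiesOver P) {y : P.intClosure E}
    (hD : P.differentOver E = Ideal.span {y}) : h.val (y : E) = exp (-(diffExponent h : ℤ)) := by
  have hy : y ≠ 0 := fun h0 ↦ differentOver_ne_bot P E (by simp [hD, h0])
  obtain ⟨d, hd⟩ := exists_eq_exp_neg_natCast (x := h.val (y : E)) (by simpa using hy)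
    (h.val_coe_le_one y)
  have pow_dvd_iff (i : ℕ) : h.center ^ i ∣ P.differentOver E ↔ i ≤ d := by
    rw [hD, Ideal.dvd_iff_le, Ideal.span_singleton_le_iff_mem, ← h.val_coe_le_exp_iff, hd,
      exp_le_exp]
    lia
  rw [hd, diffExponent, multiplicity_eq_of_dvd_of_not_dvd ((pow_dvd_iff d).2 le_rfl)
    (by rw [pow_dvd_iff]; lia)]

theorem LiesOver.mem_ramGroup_iff (h : Q.LiesOver P) (σ : Gal(E/F)) (i : ℕ) :
    σ ∈ Q.ramGroup F i ↔ ∀ z ∈ Q.ring, h.val (σ z - z) ≤ exp (-((i + 1 : ℕ) : ℤ)) := by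
  constructor
  · intro hσ z hz
    obtain ⟨w, hw, hwz⟩ := hσ ⟨z, hz⟩
    rw [← hwz]
    exact (h.mem_maximalIdeal_pow_iff _ _).1 hw
  · intro hσ z
    have mem_ring : σ (z : E) - z ∈ Q.ring :=
      (h.mem_ring_iff _).2 ((hσ z z.2).trans (by rw [← exp_zero, exp_le_exp]; lia))
    exact ⟨⟨_, mem_ring⟩, (h.mem_maximalIdeal_pow_iff _ _).2 (hσ z z.2), rfl⟩

theorem LiesOver.mem_ramGroup_of_intClosure (h : Q.LiesOver P) (σ : Gal(E/F)) (i : ℕ)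
    (hσ : ∀ b : P.intClosure E, h.val (σ (b : E) - b) ≤ exp (-((i + 1 : ℕ) : ℤ))) :
    σ ∈ Q.ramGroup F i := by
  rw [h.mem_ramGroup_iff]
  intro z hz
  have hz1 : h.val z ≤ 1 := (h.mem_ring_iff z).1 hz
  obtain ⟨b, s, hs, hbs⟩ := h.exists_mul_eq_coe hz1
  have val_s : h.val (s : E) = 1 := (h.val_coe_eq_one_iff s).2 hs
  have val_σs : h.val (σ (s : E)) = 1 := by
    have hlt : h.val (σ (s : E) - s) < h.val (s : E) := by
      rw [val_s]
      refine (hσ s).trans_lt ?_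
      rw [← exp_zero, exp_lt_exp]
      lia
    rw [← val_s, ← Valuation.map_add_eq_of_lt_left h.val hlt, add_sub_cancel]
  have sub_mul_eq : (σ z - z) * σ (s : E) = (σ (b : E) - b) - z * (σ (s : E) - s) := by
    rw [← hbs, map_mul]
    ring
  calc h.val (σ z - z) = h.val ((σ (b : E) - b) - z * (σ (s : E) - s)) := by
        rw [← sub_mul_eq, map_mul, val_σs, mul_one]
    _ ≤ max (h.val (σ (b : E) - b)) (h.val (z * (σ (s : E) - s))) := Valuation.map_sub _ _ _
    _ ≤ exp (-((i + 1 : ℕ) : ℤ)) := max_le (hσ b) <| by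
        rw [map_mul]
        exact (mul_le_of_le_one_left' hz1).trans (hσ s)

theorem LiesOver.mem_ramGroup_of_adjoin_eq_top (h : Q.LiesOver P) {π : P.intClosure E}
    (hadj : Algebra.adjoin P.ring {π} = ⊤) (σ : Gal(E/F)) (i : ℕ)
    (hσ : h.val (σ π - π) ≤ exp (-((i + 1 : ℕ) : ℤ))) : σ ∈ Q.ramGroup F i := by
  refine h.mem_ramGroup_of_intClosure σ i fun b ↦ ?_
  obtain ⟨f, rfl⟩ : ∃ f : P.ring[X], aeval π f = b := by
    have hb : b ∈ Algebra.adjoin P.ring {π} := hadj ▸ Algebra.mem_top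
    rwa [Algebra.adjoin_singleton_eq_range_aeval] at hb
  obtain ⟨c, hc⟩ := sub_dvd_eval_sub (σ • π) π (f.map (algebraMap P.ring (P.intClosure E)))
  have aeval_smul : (aeval (σ • π) f : P.intClosure E) = σ • aeval π f :=
    aeval_algHom_apply (MulSemiringAction.toAlgHom P.ring (P.intClosure E) σ) π f
  rw [eval_map_algebraMap, eval_map_algebraMap, aeval_smul] at hc
  have hcE : σ ((aeval π f : P.intClosure E) : E) - (aeval π f : P.intClosure E) =
      (σ π - π) * c := congrArg Subtype.val hc
  rw [hcE, map_mul]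
  exact (mul_le_of_le_one_right' (h.val_coe_le_one c)).trans hσ

theorem LiesOver.ramBound_eq_of_adjoin_eq_top (h : Q.LiesOver P) {π : P.intClosure E}
    (hadj : Algebra.adjoin P.ring {π} = ⊤) {σ₀ : Gal(E/F)} (hσ₀ : σ₀ ≠ 1)
    (hmax : ∀ σ : Gal(E/F), σ ≠ 1 → h.val (σ₀ π - π) ≤ h.val (σ π - π)) {m : ℕ}
    (hm : h.val (σ₀ π - π) = exp (-((m + 1 : ℕ) : ℤ))) : Q.ramBound F = m + 1 := by
  refine ramBound_eq_succ m (fun σ hσ ↦ ?_)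
    ⟨σ₀, h.mem_ramGroup_of_adjoin_eq_top hadj σ₀ m hm.le, hσ₀⟩
  by_contra hne
  have hle := (hmax σ hne).trans ((h.mem_ramGroup_iff σ _).1 hσ π (h.mem_ring π))
  rw [hm, exp_le_exp] at hle
  lia

theorem LiesOver.condExponent_eq_of_adjoin_eq_top (h : Q.LiesOver P) {π : P.intClosure E}
    (hadj : Algebra.adjoin P.ring {π} = ⊤) (hgen : Algebra.adjoin F {(π : E)} = ⊤)
    {σ₀ : Gal(E/F)} (hmax : ∀ σ : Gal(E/F), σ ≠ 1 → h.val (σ₀ π - π) ≤ h.val (σ π - π))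
    (hlt : h.val (σ₀ π - π) < 1) {t : P.ring}
    (ht : IsLocalRing.maximalIdeal P.ring = Ideal.span {t}) (N : ℕ)
    (hder : h.val (aeval (π : E) (derivative (minpoly F (π : E)))) * h.val (σ₀ π - π) =
      h.val (algebraMap F E t) ^ N) : condExponent h = N := by
  have hne : h.val (σ₀ π - π) ≠ 0 := by
    refine right_ne_zero_of_mul (hder.trans_ne (pow_ne_zero N ?_))
    rw [h.val_algebraMap_uniformizer ht]
    exact exp_ne_zero
  have hσ₀ : σ₀ ≠ 1 := by
    rintro rfl
    simp at hne
  obtain ⟨m, hm⟩ : ∃ m : ℕ, h.val (σ₀ π - π) = exp (-((m + 1 : ℕ) : ℤ)) := by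
    obtain ⟨a, ha⟩ := exists_eq_exp_neg_natCast hne hlt.le
    cases a with
    | zero => simp [ha] at hlt
    | succ m => exact ⟨m, ha⟩
  have hram := h.ramBound_eq_of_adjoin_eq_top hadj hσ₀ hmax hm
  rw [← coe_aeval_derivative_minpoly,
    h.val_eq_exp_neg_diffExponent (differentOver_eq_span hadj hgen), hm,
    h.val_algebraMap_uniformizer ht, ← exp_add, ← exp_nsmul, exp_inj, nsmul_eq_mul] at hder
  have add_eq : (diffExponent h : ℤ) + ((m + 1 : ℕ) : ℤ) = N * ramIndex h := by lia
  rw [condExponent, hram, div_eq_iff (by exact_mod_cast h.ramIndex_ne_zero)]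
  exact_mod_cast add_eq

end Monogenic

theorem adjoin_eq_top_of_isEisensteinAt {k F E : Type*} [Field k] [Field F] [Field E] [Algebra k F]
    [Algebra F E] {P : Place k F} [IsDiscreteValuationRing P.ring] {g : P.ring[X]} (hg : g.Monic)
    (hE : g.IsEisensteinAt (IsLocalRing.maximalIdeal P.ring)) (hdeg : 0 < g.natDegree)
    {π : P.intClosure E} (hπ : aeval (π : E) g = 0) (hgen : Algebra.adjoin F {(π : E)} = ⊤) :
    Algebra.adjoin P.ring {π} = ⊤ := by
  rw [eq_top_iff]
  rintro b -
  have map_adjoin : (Algebra.adjoin P.ring {π}).map (P.intClosure E).val =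
      Algebra.adjoin P.ring {(π : E)} := AlgHom.map_adjoin_singleton _ _
  have hb : (b : E) ∈ Algebra.adjoin P.ring {(π : E)} :=
    mem_adjoin_of_isEisensteinAt_of_isIntegral hg hE hdeg hπ hgen b.2
  rw [← map_adjoin] at hb
  obtain ⟨c, hc, hcb⟩ := hb
  rwa [← Subtype.ext hcb]

section Decomposition

open scoped Pointwise

attribute [local instance] isSeparable_fractionRing_intClosure

theorem coe_galSMul {k F E : Type*} [Field k] [Field F] [Field E] [Algebra k F] [Algebra F E]
    {P : Place k F} (σ : Gal(E/F)) (b : P.intClosure E) :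
    ((σ • b : P.intClosure E) : E) = σ (b : E) := rfl

variable {k F E : Type*} [Field k] [Field F] [Field E] [Algebra k F] [Algebra k E] [Algebra F E]
  {P : Place k F} {Q : Place k E}

/-- The decomposition group of `Q`, as the stabilizer of the prime of the integral closure of
`𝒪_P` that corresponds to `Q`. -/
abbrev LiesOver.decomp (h : Q.LiesOver P) : Subgroup Gal(E/F) :=
  MulAction.stabilizer Gal(E/F) h.center

variable [IsDiscreteValuationRing P.ring]

theorem LiesOver.isMaximal_center (h : Q.LiesOver P) : h.center.IsMaximal :=
  h.isPrime_center.isMaximal h.center_ne_bot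

variable [FiniteDimensional F E] [Algebra.IsSeparable F E]

theorem LiesOver.val_apply_coe_of_mem_decomp (h : Q.LiesOver P) {σ : Gal(E/F)} (hσ : σ ∈ h.decomp)
    (b : P.intClosure E) : h.val (σ (b : E)) = h.val b := by
  by_cases hb : b = 0
  · simp [hb]
  have val_le_iff (i : ℕ) :
      h.val (σ (b : E)) ≤ exp (-(i : ℤ)) ↔ h.val (b : E) ≤ exp (-(i : ℤ)) := by
    rw [h.val_coe_le_exp_iff, ← smul_mem_pow_iff_of_mem_stabilizer hσ, ← h.val_coe_le_exp_iff,
      coe_galSMul]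
  obtain ⟨m, hm⟩ := exists_eq_exp_neg_natCast (x := h.val (σ (b : E))) (by simpa using hb)
    (h.val_coe_le_one (σ • b))
  obtain ⟨n, hn⟩ := exists_eq_exp_neg_natCast (x := h.val (b : E)) (by simpa using hb)
    (h.val_coe_le_one b)
  exact le_antisymm (hn ▸ (val_le_iff n).2 hn.le) (hm ▸ (val_le_iff m).1 hm.le)

theorem LiesOver.val_apply_of_mem_decomp (h : Q.LiesOver P) {σ : Gal(E/F)} (hσ : σ ∈ h.decomp)
    (z : E) : h.val (σ z) = h.val z := by
  obtain ⟨b, s, -, rfl⟩ := IsFractionRing.div_surjective (A := P.intClosure E) z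
  simp only [map_div₀]
  exact congrArg₂ _ (h.val_apply_coe_of_mem_decomp hσ b) (h.val_apply_coe_of_mem_decomp hσ s)

theorem LiesOver.mem_ramGroup_zero_iff (h : Q.LiesOver P) (σ : Gal(E/F)) :
    σ ∈ Q.ramGroup F 0 ↔ σ ∈ h.center.inertia Gal(E/F) := by
  have val_sub_le_iff (b : P.intClosure E) :
      h.val (σ (b : E) - b) ≤ exp (-((0 + 1 : ℕ) : ℤ)) ↔ σ • b - b ∈ h.center := by
    rw [← h.val_coe_lt_one_iff, lt_one_iff_le_exp_neg_one]
    rfl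
  refine ⟨fun hσ b ↦ ?_, fun hσ ↦ h.mem_ramGroup_of_intClosure σ 0 fun b ↦
    (val_sub_le_iff b).2 (hσ b)⟩
  exact (val_sub_le_iff b).1 ((h.mem_ramGroup_iff σ 0).1 hσ b (h.mem_ring b))

theorem LiesOver.ramGroup_subset_decomp (h : Q.LiesOver P) (i : ℕ) :
    Q.ramGroup F i ⊆ h.decomp := fun σ hσ ↦
  Ideal.inertia_le_stabilizer _ ((h.mem_ramGroup_zero_iff σ).1 (ramGroup_antitone i.zero_le hσ))

theorem LiesOver.exists_map_maximalIdeal_eq (h : Q.LiesOver P) :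
    ∃ I, (IsLocalRing.maximalIdeal P.ring).map (algebraMap P.ring (P.intClosure E)) =
      h.center ^ ramIndex h * I ∧ ¬ I ≤ h.center := by
  obtain ⟨I, hI⟩ : h.center ^ ramIndex h ∣
      (IsLocalRing.maximalIdeal P.ring).map (algebraMap P.ring (P.intClosure E)) :=
    Ideal.dvd_iff_le.2 Ideal.le_pow_ramificationIdx'
  refine ⟨I, hI, fun hle ↦ ?_⟩
  obtain ⟨t, ht⟩ := (IsPrincipalIdealRing.principal (IsLocalRing.maximalIdeal P.ring)).principal
  have mem_pow_succ : algebraMap P.ring (P.intClosure E) t ∈ h.center ^ (ramIndex h + 1) := by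
    rw [pow_succ]
    refine Ideal.mul_mono_right hle (hI ▸ Ideal.mem_map_of_mem _ ?_)
    exact ht ▸ Ideal.mem_span_singleton_self t
  have val_le : h.val (algebraMap F E t) ≤ exp (-((ramIndex h + 1 : ℕ) : ℤ)) :=
    (h.val_coe_le_exp_iff _ _).2 mem_pow_succ
  rw [h.val_algebraMap_uniformizer ht, exp_le_exp] at val_le
  lia

end Decomposition

section Galois

open scoped Pointwise

attribute [local instance] isSeparable_fractionRing_intClosure

variable {k F E : Type*} [Field k] [Field F] [Field E] [Algebra k F] [Algebra F E] {P : Place k F}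
  [IsDiscreteValuationRing P.ring] [FiniteDimensional F E] [IsGalois F E]

instance isGaloisGroup_intClosure : IsGaloisGroup Gal(E/F) P.ring (P.intClosure E) :=
  IsGaloisGroup.of_isFractionRing Gal(E/F) P.ring (P.intClosure E) F E

theorem algebraMap_intTrace_eq_sum (x : P.intClosure E) :
    algebraMap P.ring (P.intClosure E) (Algebra.intTrace P.ring (P.intClosure E) x) =
      ∑ σ : Gal(E/F), σ • x := by
  apply IsFractionRing.injective (P.intClosure E) E
  rw [← IsScalarTower.algebraMap_apply P.ring (P.intClosure E) E,
    IsScalarTower.algebraMap_apply P.ring F E, Algebra.algebraMap_intTrace (L := E),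
    trace_eq_sum_automorphisms, map_sum]
  rfl

variable [Algebra k E] {Q : Place k E}

theorem LiesOver.card_decomp_eq (h : Q.LiesOver P) :
    Nat.card h.decomp = ramIndex h * h.center.inertiaDeg P.ring :=
  natCard_stabilizer_eq_ramificationIdx_mul_inertiaDeg _
    (IsDiscreteValuationRing.not_a_field P.ring) _

/-- For `y = 1` the hypothesis says that the order of the decomposition group is prime to the
residue characteristic. -/
theorem LiesOver.diffExponent_eq_ramIndex_sub_one (h : Q.LiesOver P) [Fintype h.decomp]
    {y : P.intClosure E} (hy : ∑ σ : h.decomp, σ • y ∉ h.center) :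
    diffExponent h = ramIndex h - 1 := by
  have isMaximal_center := h.isMaximal_center
  obtain ⟨I, hI, hnle⟩ := h.exists_map_maximalIdeal_eq
  rw [diffExponent, differentOver_eq]
  refine multiplicity_eq_of_dvd_of_not_dvd (pow_sub_one_dvd_differentIdeal P.ring h.center
    (ramIndex h) (IsDiscreteValuationRing.not_a_field P.ring) ⟨I, hI⟩) ?_
  rw [Nat.sub_add_cancel (Nat.one_le_iff_ne_zero.2 h.ramIndex_ne_zero)]
  have not_dvd := not_pow_dvd_differentIdeal_of_sum_stabilizer_smul_notMem
    (algebraMap_intTrace_eq_sum (P := P) (E := E)) (IsLocalRing.maximalIdeal P.ring) h.center I hI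
    hnle (y := y)
  exact not_dvd hy

theorem LiesOver.inertia_center_eq_bot (h : Q.LiesOver P) (h0 : ∀ σ ∈ Q.ramGroup F 0, σ = 1) :
    h.center.inertia Gal(E/F) = ⊥ :=
  (Subgroup.eq_bot_iff_forall _).2 fun σ hσ ↦ h0 σ ((h.mem_ramGroup_zero_iff σ).2 hσ)

theorem LiesOver.ramIndex_eq_one (h : Q.LiesOver P) (h0 : ∀ σ ∈ Q.ramGroup F 0, σ = 1) :
    ramIndex h = 1 := by
  have isMaximal_center := h.isMaximal_center
  have card_le : Nat.card h.decomp ≤ h.center.inertiaDeg P.ring :=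
    natCard_stabilizer_le_inertiaDeg_of_inertia_eq_bot (IsLocalRing.maximalIdeal P.ring) h.center
      (h.inertia_center_eq_bot h0)
  have card_pos : 0 < Nat.card h.decomp := Nat.card_pos
  rw [h.card_decomp_eq] at card_le card_pos
  exact le_antisymm (Nat.le_of_mul_le_mul_right (by simpa using card_le)
    (Nat.pos_of_mul_pos_left card_pos)) (Nat.one_le_iff_ne_zero.2 h.ramIndex_ne_zero)

theorem LiesOver.condExponent_eq_zero (h : Q.LiesOver P) (h0 : ∀ σ ∈ Q.ramGroup F 0, σ = 1) :
    condExponent h = 0 := by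
  have isMaximal_center := h.isMaximal_center
  let _ : Fintype h.decomp := Fintype.ofFinite _
  obtain ⟨y, hy⟩ : ∃ y : P.intClosure E, ∑ σ : h.decomp, σ • y ∉ h.center :=
    exists_sum_stabilizer_smul_notMem_of_inertia_eq_bot h.center (h.inertia_center_eq_bot h0)
  simp [condExponent, ramBound_eq_zero h0, h.diffExponent_eq_ramIndex_sub_one hy,
    h.ramIndex_eq_one h0]

theorem LiesOver.condExponent_eq_one (h : Q.LiesOver P) (he : ramIndex h ≠ 1)
    (hcard : h.val (Nat.card h.decomp : E) = 1) {π : E} (hπ : h.val π = exp (-1))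
    (hσπ : ∀ σ ∈ h.decomp, σ ≠ 1 → h.val (σ π - π) = h.val π) : condExponent h = 1 := by
  let _ : Fintype h.decomp := Fintype.ofFinite _
  have diffExponent_eq : diffExponent h = ramIndex h - 1 := by
    refine h.diffExponent_eq_ramIndex_sub_one (y := 1) ?_
    rw [← h.val_coe_eq_one_iff, ← hcard]
    simp [smul_one]
  have ramBound_eq : Q.ramBound F = 0 + 1 := by
    refine ramBound_eq_succ 0 (fun σ hσ ↦ ?_) ?_
    · by_contra hσ1
      have val_le := (h.mem_ramGroup_iff σ _).1 hσ π
        ((h.mem_ring_iff π).2 (hπ.trans_le (by rw [← exp_zero, exp_le_exp]; lia)))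
      rw [hσπ σ (h.ramGroup_subset_decomp _ hσ) hσ1, hπ, exp_le_exp] at val_le
      lia
    · by_contra! h0
      exact he (h.ramIndex_eq_one h0)
  have he0 := h.ramIndex_ne_zero
  rw [condExponent, diffExponent_eq, ramBound_eq, div_eq_one_iff_eq (by exact_mod_cast he0),
    Nat.cast_sub (Nat.one_le_iff_ne_zero.2 he0)]
  push_cast
  ring

theorem LiesOver.ramIndex_eq_card_of_decomp_le (h : Q.LiesOver P) {H : Subgroup Gal(E/F)}
    (hH : h.decomp ≤ H) {t : P.ring} (ht : IsLocalRing.maximalIdeal P.ring = Ideal.span {t})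
    {π : E} (hπ : h.val π ^ Nat.card H = h.val (algebraMap F E t)) :
    ramIndex h = Nat.card H ∧ h.decomp = H ∧ h.val π = exp (-1) := by
  rw [h.val_algebraMap_uniformizer ht] at hπ
  have hπ0 : h.val π ≠ 0 := by
    intro h0
    rw [h0, zero_pow Nat.card_pos.ne'] at hπ
    exact exp_ne_zero hπ.symm
  have card_mul_log : (Nat.card H : ℤ) * log (h.val π) = -(ramIndex h : ℤ) := by
    rw [← exp_log hπ0, ← exp_nsmul, exp_inj] at hπ
    simpa using hπ
  have card_dvd : Nat.card H ∣ ramIndex h := by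
    rw [← Int.natCast_dvd_natCast, ← dvd_neg, ← card_mul_log]
    exact dvd_mul_right _ _
  have dvd_card_decomp : ramIndex h ∣ Nat.card h.decomp := ⟨_, h.card_decomp_eq⟩
  have ramIndex_eq : ramIndex h = Nat.card H :=
    Nat.dvd_antisymm (dvd_card_decomp.trans (Subgroup.card_dvd_of_le hH)) card_dvd
  have he0 : (ramIndex h : ℤ) ≠ 0 := by exact_mod_cast h.ramIndex_ne_zero
  refine ⟨ramIndex_eq, Subgroup.eq_of_le_of_card_ge hH ?_, ?_⟩
  · exact Nat.le_of_dvd Nat.card_pos (card_dvd.trans dvd_card_decomp)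
  · rw [← exp_log hπ0, exp_inj]
    rw [← ramIndex_eq] at card_mul_log
    exact mul_left_cancel₀ he0 (card_mul_log.trans (mul_neg_one _).symm)

end Galois
section Existence

variable {k F E : Type*} [Field k] [Field F] [Field E] [Algebra k F] [Algebra F E]

theorem exists_valuationSubring_comap_eq (V : ValuationSubring F) (E : Type*) [Field E]
    [Algebra F E] : ∃ W : ValuationSubring E, W.comap (algebraMap F E) = V := by
  obtain ⟨W, hVW, hlocal⟩ :=
    IsLocalRing.exists_factor_valuationRing ((algebraMap F E).comp V.subtype)
  refine ⟨W, SetLike.ext fun x ↦ ⟨fun hx ↦ ?_, fun hx ↦ hVW ⟨x, hx⟩⟩⟩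
  by_contra hxV
  have hx0 : x ≠ 0 := ne_of_mem_of_not_mem (zero_mem V) hxV |>.symm
  have hxinv : x⁻¹ ∈ V := (V.mem_or_inv_mem x).resolve_left hxV
  have isUnit_inv : IsUnit (⟨x⁻¹, hxinv⟩ : V) := by
    refine hlocal.map_nonunit _ (IsUnit.of_mul_eq_one ⟨_, hx⟩ (Subtype.ext ?_))
    simp [hx0]
  obtain ⟨y, hy⟩ := isUnit_inv.exists_right_inv
  have hxy : (y : F) = x := (eq_inv_of_mul_eq_one_right (congrArg Subtype.val hy)).trans (inv_inv x)
  exact hxV (hxy ▸ y.2)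

variable [Algebra k E]

theorem exists_liesOver [IsScalarTower k F E] (P : Place k F) : ∃ Q : Place k E, Q.LiesOver P := by
  obtain ⟨W, hW⟩ := exists_valuationSubring_comap_eq P.ring E
  refine ⟨⟨W, fun c ↦ ?_, ?_⟩, hW.symm⟩
  · rw [IsScalarTower.algebraMap_apply k F E, ← ValuationSubring.mem_comap, hW]
    exact P.algebraMap_mem c
  · rintro rfl
    exact P.ne_top (hW ▸ rfl)

variable {P : Place k F} {Q : Place k E} [IsDiscreteValuationRing P.ring] [FiniteDimensional F E]
  [Algebra.IsSeparable F E]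

theorem LiesOver.exists_val_isEquiv_comap (h : Q.LiesOver P) (L : Type*) [Field L] [Algebra E L] :
    ∃ W : ValuationSubring L, h.val.IsEquiv (W.valuation.comap (algebraMap E L)) := by
  obtain ⟨W, hW⟩ := exists_valuationSubring_comap_eq Q.ring L
  refine ⟨W, (Valuation.isEquiv_iff_val_le_one).2 fun {x} ↦ ?_⟩
  rw [← h.mem_ring_iff, ← hW, ValuationSubring.mem_comap, Valuation.comap_apply,
    W.valuation_le_one_iff]

end Existence

end Place

/-! ### The places of the rational function field -/

section ValuationRings

variable {K : Type*} [Field K]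

theorem exists_eq_valuationSubring_of_algebraMap_mem (A : Type*) [CommRing A] [IsDedekindDomain A]
    [Algebra A K] [IsFractionRing A K] {V : ValuationSubring K} (hV : V ≠ ⊤)
    (hA : ∀ a : A, algebraMap A K a ∈ V) :
    ∃ 𝔭 : HeightOneSpectrum A, V = (𝔭.valuation K).valuationSubring := by
  let incl : A →+* V := (algebraMap A K).codRestrict V hA
  let center : Ideal A := (IsLocalRing.maximalIdeal V).comap incl
  have inv_mem (a : A) (ha : a ∉ center) : (algebraMap A K a)⁻¹ ∈ V := by
    obtain ⟨y, hy⟩ := (IsLocalRing.notMem_maximalIdeal.1 ha).exists_right_inv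
    exact eq_inv_of_mul_eq_one_right (congrArg Subtype.val hy) ▸ y.2
  have center_ne_bot : center ≠ ⊥ := by
    intro hbot
    refine hV (eq_top_iff.2 fun x _ ↦ ?_)
    obtain ⟨a, b, hb, rfl⟩ := IsFractionRing.div_surjective (A := A) x
    rw [div_eq_mul_inv]
    refine mul_mem (hA a) (inv_mem b fun hmem ↦ nonZeroDivisors.ne_zero hb ?_)
    rwa [hbot, Ideal.mem_bot] at hmem
  let 𝔭 : HeightOneSpectrum A := ⟨center, Ideal.comap_isPrime _ _, center_ne_bot⟩
  have valuationSubringAtPrime_le : 𝔭.valuationSubringAtPrime K ≤ V := by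
    rintro x ⟨a, s, hs, rfl⟩
    exact mul_mem (hA a) (inv_mem s hs)
  exact ⟨𝔭, (ValuationSubring.eq_of_le_of_ne_top _ valuationSubringAtPrime_le hV).symm.trans
    𝔭.valuationSubringAtPrime_eq_valuationSubring⟩

theorem maximalIdeal_valuationSubring_eq_span {v : Valuation K ℤᵐ⁰} {t : v.valuationSubring}
    (ht : v t = exp (-1)) : IsLocalRing.maximalIdeal v.valuationSubring = Ideal.span {t} := by
  have isNontrivial : v.IsNontrivial := ⟨t, by simp [ht], by simp [ht, ← exp_zero, -exp_neg]⟩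
  refine Valuation.IsUniformizer.is_generator ?_
  have generator_eq :=
    Valuation.IsRankOneDiscrete.generator_eq_exp_neg_one_of_mem_range (v := v) ⟨(t : K), ht⟩
  exact ht.trans (congrArg Units.val generator_eq).symm

end ValuationRings

section RationalPlaces

variable {k : Type*} [Field k]

theorem algebraMap_X_sub_C (α : k) :
    algebraMap k[X] (RatFunc k) (X - C α) = RatFunc.X - RatFunc.C α := by
  simp

theorem ratFunc_X_sub_C_ne_zero (α : k) : (RatFunc.X - RatFunc.C α : RatFunc k) ≠ 0 :=
  algebraMap_X_sub_C α ▸ RatFunc.algebraMap_ne_zero (X_sub_C_ne_zero α)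

theorem adicValuation_X_sub_C (α : k) :
    (primeXSubC α).valuation (RatFunc k) (RatFunc.X - RatFunc.C α) = exp (-1) := by
  rw [← algebraMap_X_sub_C, HeightOneSpectrum.valuation_of_algebraMap]
  exact HeightOneSpectrum.intValuation_singleton _ (X_sub_C_ne_zero α) rfl

open scoped Classical in
theorem inftyValuation_X_sub_C (α : k) :
    RatFunc.inftyValuation k (RatFunc.X - RatFunc.C α) = exp 1 := by
  rw [← algebraMap_X_sub_C, RatFunc.inftyValuation_apply,
    RatFunc.inftyValuation.polynomial k (X_sub_C_ne_zero α)]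
  simp

theorem placeInfty_X_sub_C_notMem (α : k) : RatFunc.X - RatFunc.C α ∉ (placeInfty k).ring := by
  rw [placeInfty, Valuation.mem_valuationSubring_iff, inftyValuation_X_sub_C]
  decide

theorem placeZero_X_sub_C_inv_notMem (α : k) :
    (RatFunc.X - RatFunc.C α)⁻¹ ∉ (placeZero α).ring := by
  rw [placeZero, Valuation.mem_valuationSubring_iff, map_inv₀, adicValuation_X_sub_C]
  decide

theorem maximalIdeal_placeInfty {α : k} {t : (placeInfty k).ring}
    (ht : (t : RatFunc k) = (RatFunc.X - RatFunc.C α)⁻¹) :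
    IsLocalRing.maximalIdeal (placeInfty k).ring = Ideal.span {t} :=
  maximalIdeal_valuationSubring_eq_span
    (by rw [ht, map_inv₀, inftyValuation_X_sub_C, ← exp_neg])

theorem maximalIdeal_placeZero {α : k} {t : (placeZero α).ring}
    (ht : (t : RatFunc k) = RatFunc.X - RatFunc.C α) :
    IsLocalRing.maximalIdeal (placeZero α).ring = Ideal.span {t} :=
  maximalIdeal_valuationSubring_eq_span (by rw [ht, adicValuation_X_sub_C])

variable {P : Place k (RatFunc k)}

theorem Place.isTrivialOn_valuation (P : Place k (RatFunc k)) : P.ring.valuation.IsTrivialOn k :=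
  Valuation.IsTrivialOn.of_le_one _ fun a ↦ (P.ring.valuation_le_one_iff _).2 (P.algebraMap_mem a)

theorem eq_placeInfty_of_X_notMem (hX : RatFunc.X ∉ P.ring) : P = placeInfty k := by
  classical
  have isTrivialOn := P.isTrivialOn_valuation
  have isEquiv := RatFunc.valuation_isEquiv_inftyValuation_of_one_lt_valuation_X
    (not_le.1 (mt (P.ring.valuation_le_one_iff _).1 hX))
  rw [Valuation.isEquiv_iff_valuationSubring, P.ring.valuationSubring_valuation] at isEquiv
  exact Place.ext (isEquiv.trans (by congr!))

theorem exists_ring_eq_of_X_mem (hX : RatFunc.X ∈ P.ring) :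
    ∃ 𝔭 : HeightOneSpectrum k[X], P.ring = (𝔭.valuation (RatFunc k)).valuationSubring := by
  refine exists_eq_valuationSubring_of_algebraMap_mem k[X] P.ne_top fun p ↦ ?_
  induction p using Polynomial.induction_on' with
  | add p q hp hq => exact map_add (algebraMap k[X] (RatFunc k)) p q ▸ add_mem hp hq
  | monomial i a =>
    rw [RatFunc.algebraMap_monomial]
    exact mul_mem (P.algebraMap_mem a) (pow_mem hX i)

instance Place.isDiscreteValuationRing_ratFunc (P : Place k (RatFunc k)) :
    IsDiscreteValuationRing P.ring := by
  by_cases hX : RatFunc.X ∈ P.ring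
  · obtain ⟨𝔭, h𝔭⟩ := exists_ring_eq_of_X_mem hX
    rw [h𝔭]
    infer_instance
  · rw [eq_placeInfty_of_X_notMem hX, placeInfty]
    infer_instance

theorem eq_placeInfty {α : k} (h : RatFunc.X - RatFunc.C α ∉ P.ring) : P = placeInfty k :=
  eq_placeInfty_of_X_notMem fun hX ↦ h (sub_mem hX (P.algebraMap_mem α))

theorem eq_placeZero {α : k} (h : (RatFunc.X - RatFunc.C α)⁻¹ ∉ P.ring) : P = placeZero α := by
  have X_sub_C_mem : RatFunc.X - RatFunc.C α ∈ P.ring := (P.ring.mem_or_inv_mem _).resolve_right h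
  obtain ⟨𝔭, h𝔭⟩ : ∃ 𝔭 : HeightOneSpectrum k[X], P.ring = (𝔭.valuation _).valuationSubring :=
    exists_ring_eq_of_X_mem (by
      simpa [RatFunc.algebraMap_eq_C] using add_mem X_sub_C_mem (P.algebraMap_mem α))
  have valuation_lt_one : 𝔭.valuation (RatFunc k) (RatFunc.X - RatFunc.C α) < 1 := by
    rwa [h𝔭, Valuation.mem_valuationSubring_iff, map_inv₀, not_le, one_lt_inv₀] at h
    exact (Valuation.pos_iff _).2 (ratFunc_X_sub_C_ne_zero α)
  have eq_primeXSubC : 𝔭 = primeXSubC α := by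
    rw [← algebraMap_X_sub_C, HeightOneSpectrum.valuation_lt_one_iff_mem,
      ← Ideal.span_singleton_le_iff_mem] at valuation_lt_one
    have isMaximal : (primeXSubC α).asIdeal.IsMaximal := (primeXSubC α).isMaximal
    exact HeightOneSpectrum.ext (isMaximal.eq_of_le 𝔭.isPrime.ne_top valuation_lt_one).symm
  subst eq_primeXSubC
  exact Place.ext h𝔭

theorem placeInfty_ne_placeZero (α : k) : placeInfty k ≠ placeZero α := by
  intro h
  exact placeInfty_X_sub_C_notMem α
    (h ▸ ((placeZero α).ring.mem_or_inv_mem _).resolve_right (placeZero_X_sub_C_inv_notMem α))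

end RationalPlaces

/-! ### Torsion of the Carlitz module -/

section FiniteFieldProducts

variable {k L : Type*} [Field k] [Fintype k] [Field L] [Algebra k L]

theorem card_sub_one_ne_zero {k : Type*} [Fintype k] [Nontrivial k] : Fintype.card k - 1 ≠ 0 :=
  Nat.sub_ne_zero_of_lt Fintype.one_lt_card

theorem natCast_card_eq_zero (k : Type*) {R : Type*} [Field k] [Fintype k] [Semiring R]
    [Algebra k R] : (Fintype.card k : R) = 0 := by
  rw [← map_natCast (algebraMap k R), FiniteField.cast_card_eq_zero, map_zero]

theorem smul_pow_card_sub_one {c : k} (hc : c ≠ 0) (x : L) :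
    (c • x) ^ (Fintype.card k - 1) = x ^ (Fintype.card k - 1) := by
  rw [_root_.smul_pow, FiniteField.pow_card_sub_one_eq_one c hc, one_smul]

theorem prod_X_sub_C_eq_X_pow_card_sub_X (k : Type*) [Field k] [Fintype k] :
    ∏ c : k, (X - C c) = X ^ Fintype.card k - X := by
  have roots_eq := FiniteField.roots_X_pow_card_sub_X k
  have card_roots : Multiset.card (X ^ Fintype.card k - X : k[X]).roots =
      (X ^ Fintype.card k - X : k[X]).natDegree := by
    rw [roots_eq, FiniteField.X_pow_card_sub_X_natDegree_eq k Fintype.one_lt_card]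
    rfl
  rw [← prod_multiset_X_sub_C_of_monic_of_roots_card_eq
    (monic_X_pow_sub (by rw [degree_X]; exact_mod_cast Fintype.one_lt_card)) card_roots, roots_eq]
  rfl

theorem prod_sub_smul (x y : L) :
    ∏ c : k, (x - c • y) = x * (x ^ (Fintype.card k - 1) - y ^ (Fintype.card k - 1)) := by
  by_cases hy : y = 0
  · simp [hy, card_sub_one_ne_zero, mul_pow_sub_one Fintype.card_ne_zero]
  · have eval_div := congrArg (aeval (x / y)) (prod_X_sub_C_eq_X_pow_card_sub_X k)
    simp only [map_prod, map_sub, aeval_X, aeval_C, map_pow] at eval_div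
    have factor_eq (c : k) : x - c • y = y * (x / y - algebraMap k L c) := by
      rw [Algebra.smul_def]
      field_simp
    simp only [factor_eq, Finset.prod_mul_distrib, Finset.prod_const, Finset.card_univ, eval_div]
    rw [mul_sub, div_pow, mul_div_cancel₀ _ (pow_ne_zero _ hy),
      ← pow_sub_one_mul Fintype.card_ne_zero x, ← pow_sub_one_mul Fintype.card_ne_zero y]
    field_simp

theorem exists_eq_smul_of_pow_card_sub_one_eq {x y : L}
    (h : x ^ (Fintype.card k - 1) = y ^ (Fintype.card k - 1)) : ∃ c : k, x = c • y := by
  have prod_eq_zero := prod_sub_smul (k := k) x y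
  rw [h, sub_self, mul_zero, Finset.prod_eq_zero_iff] at prod_eq_zero
  obtain ⟨c, -, hc⟩ := prod_eq_zero
  exact ⟨c, sub_eq_zero.1 hc⟩

end FiniteFieldProducts

section CarlitzPolynomials

variable {R : Type*} [CommRing R]

theorem isEisensteinAt_of_map_mk_eq_X_pow {p : Ideal R} (hp : p ≠ ⊤) {f : R[X]} (hf : f.Monic)
    {N : ℕ} (hN : f.map (Ideal.Quotient.mk p) = X ^ N) (h0 : f.coeff 0 ∉ p ^ 2) :
    f.IsEisensteinAt p := by
  have : Nontrivial (R ⧸ p) := Ideal.Quotient.nontrivial_iff.2 hp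
  refine hf.isEisensteinAt_of_mem_of_notMem hp (fun {i} hi ↦ ?_) h0
  rw [← hf.natDegree_map (Ideal.Quotient.mk p), hN, natDegree_X_pow] at hi
  rw [← Ideal.Quotient.eq_zero_iff_mem, ← coeff_map, hN, coeff_X_pow, if_neg hi.ne]

/-- The polynomials `h_j` with `φ^j(z) = z h_j(z^{q-1})`, where `φ(z) = z^q + t z`. -/
def carlitzFactor (q : ℕ) (t : R) : ℕ → R[X]
  | 0 => 1
  | j + 1 => X * carlitzFactor q t j ^ q + C t * carlitzFactor q t j

/-- The Eisenstein polynomial whose roots are the `(q-1)`-st powers of the generators of the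
`T^{n+1}`-torsion. -/
def carlitzPsi (q : ℕ) (t : R) (n : ℕ) : R[X] :=
  X * carlitzFactor q t n ^ (q - 1) + C t

/-- The polynomial whose roots are the generators of the `T^{n+1}`-torsion. -/
def carlitzPhi (q : ℕ) (t : R) (n : ℕ) : R[X] :=
  expand R (q - 1) (carlitzPsi q t n)

/-- The polynomial `φ^j(X)`, where `φ(z) = z^q + t z`. -/
def carlitzPoly (q : ℕ) (t : R) (j : ℕ) : R[X] :=
  X * expand R (q - 1) (carlitzFactor q t j)

variable {q : ℕ} (t : R)

theorem degree_C_mul_lt_degree_X_mul_pow [Nontrivial R] {f : R[X]} (hf : f.Monic) (hq : q ≠ 0) :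
    (C t * f).degree < (X * f ^ q).degree := by
  refine degree_lt_degree ((natDegree_C_mul_le _ _).trans_lt ?_)
  rw [monic_X.natDegree_mul (hf.pow q), natDegree_X, hf.natDegree_pow]
  have := Nat.le_mul_of_pos_left f.natDegree (Nat.pos_of_ne_zero hq)
  lia

theorem monic_carlitzFactor (hq : q ≠ 0) (j : ℕ) : (carlitzFactor q t j).Monic := by
  nontriviality R
  induction j with
  | zero => exact monic_one
  | succ j ih =>
    exact (monic_X.mul (ih.pow q)).add_of_left (degree_C_mul_lt_degree_X_mul_pow t ih hq)

theorem natDegree_carlitzFactor_succ [Nontrivial R] (hq : q ≠ 0) (j : ℕ) :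
    (carlitzFactor q t (j + 1)).natDegree = 1 + q * (carlitzFactor q t j).natDegree := by
  have hm := monic_carlitzFactor t hq j
  rw [carlitzFactor, natDegree_add_eq_left_of_degree_lt (degree_C_mul_lt_degree_X_mul_pow t hm hq),
    monic_X.natDegree_mul (hm.pow q), natDegree_X, hm.natDegree_pow]

theorem one_add_mul_natDegree_carlitzFactor [Nontrivial R] (hq : q ≠ 0) (j : ℕ) :
    1 + (q - 1) * (carlitzFactor q t j).natDegree = q ^ j := by
  obtain ⟨m, rfl⟩ := Nat.exists_eq_succ_of_ne_zero hq
  induction j with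
  | zero => simp [carlitzFactor]
  | succ j ih =>
    rw [natDegree_carlitzFactor_succ t hq, pow_succ, ← ih]
    simp only [Nat.succ_eq_add_one, Nat.add_sub_cancel]
    ring

theorem natDegree_X_mul_carlitzFactor_pow [Nontrivial R] (hq : q ≠ 0) (n : ℕ) :
    (X * carlitzFactor q t n ^ (q - 1)).natDegree = q ^ n := by
  have hm := monic_carlitzFactor t hq n
  rw [monic_X.natDegree_mul (hm.pow _), natDegree_X, hm.natDegree_pow,
    one_add_mul_natDegree_carlitzFactor t hq]

theorem degree_C_lt_degree_X_mul_carlitzFactor_pow [Nontrivial R] (hq : q ≠ 0) (n : ℕ) :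
    (C t : R[X]).degree < (X * carlitzFactor q t n ^ (q - 1)).degree := by
  refine degree_lt_degree ?_
  rw [natDegree_C, natDegree_X_mul_carlitzFactor_pow t hq]
  exact Nat.pow_pos (Nat.pos_of_ne_zero hq)

theorem monic_carlitzPsi (hq : q ≠ 0) (n : ℕ) : (carlitzPsi q t n).Monic := by
  nontriviality R
  exact (monic_X.mul ((monic_carlitzFactor t hq n).pow _)).add_of_left
    (degree_C_lt_degree_X_mul_carlitzFactor_pow t hq n)

theorem natDegree_carlitzPsi [Nontrivial R] (hq : q ≠ 0) (n : ℕ) :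
    (carlitzPsi q t n).natDegree = q ^ n := by
  rw [carlitzPsi, natDegree_add_eq_left_of_degree_lt
    (degree_C_lt_degree_X_mul_carlitzFactor_pow t hq n), natDegree_X_mul_carlitzFactor_pow t hq]

theorem monic_carlitzPhi (hq : 1 < q) (n : ℕ) : (carlitzPhi q t n).Monic :=
  (monic_carlitzPsi t (by lia) n).expand (by lia)

theorem natDegree_carlitzPhi [Nontrivial R] (hq : q ≠ 0) (n : ℕ) :
    (carlitzPhi q t n).natDegree = q ^ n * (q - 1) := by
  rw [carlitzPhi, natDegree_expand, natDegree_carlitzPsi t hq]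

theorem map_carlitzFactor {S : Type*} [CommRing S] (f : R →+* S) (j : ℕ) :
    (carlitzFactor q t j).map f = carlitzFactor q (f t) j := by
  induction j with
  | zero => simp [carlitzFactor]
  | succ j ih => simp [carlitzFactor, ih]

theorem map_carlitzPsi {S : Type*} [CommRing S] (f : R →+* S) (n : ℕ) :
    (carlitzPsi q t n).map f = carlitzPsi q (f t) n := by
  simp [carlitzPsi, map_carlitzFactor]

theorem map_carlitzPhi {S : Type*} [CommRing S] (f : R →+* S) (n : ℕ) :
    (carlitzPhi q t n).map f = carlitzPhi q (f t) n := by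
  rw [carlitzPhi, map_expand, map_carlitzPsi, carlitzPhi]

theorem exists_carlitzFactor_zero_eq_X_pow (j : ℕ) : ∃ N, carlitzFactor q (0 : R) j = X ^ N := by
  induction j with
  | zero => exact ⟨0, by simp [carlitzFactor]⟩
  | succ j ih =>
    obtain ⟨N, hN⟩ := ih
    exact ⟨1 + N * q, by simp [carlitzFactor, hN, pow_add, pow_mul]⟩

theorem exists_carlitzPsi_zero_eq_X_pow (n : ℕ) : ∃ N, carlitzPsi q (0 : R) n = X ^ N := by
  obtain ⟨N, hN⟩ := exists_carlitzFactor_zero_eq_X_pow (R := R) (q := q) n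
  exact ⟨1 + N * (q - 1), by simp [carlitzPsi, hN, pow_add, pow_mul]⟩

theorem coeff_zero_carlitzPsi (n : ℕ) : (carlitzPsi q t n).coeff 0 = t := by
  simp [carlitzPsi]

variable {t} in
theorem carlitzPsi_isEisensteinAt (hq : q ≠ 0) (n : ℕ) {p : Ideal R} (hp : p ≠ ⊤) (ht : t ∈ p)
    (ht2 : t ∉ p ^ 2) : (carlitzPsi q t n).IsEisensteinAt p := by
  obtain ⟨N, hN⟩ := exists_carlitzPsi_zero_eq_X_pow (R := R ⧸ p) (q := q) n
  refine isEisensteinAt_of_map_mk_eq_X_pow hp (monic_carlitzPsi t hq n) (N := N) ?_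
    (by rwa [coeff_zero_carlitzPsi])
  rw [map_carlitzPsi, Ideal.Quotient.eq_zero_iff_mem.2 ht, hN]

variable {t} in
theorem carlitzPhi_isEisensteinAt (hq : 1 < q) (n : ℕ) {p : Ideal R} (hp : p ≠ ⊤) (ht : t ∈ p)
    (ht2 : t ∉ p ^ 2) : (carlitzPhi q t n).IsEisensteinAt p := by
  obtain ⟨N, hN⟩ := exists_carlitzPsi_zero_eq_X_pow (R := R ⧸ p) (q := q) n
  refine isEisensteinAt_of_map_mk_eq_X_pow hp (monic_carlitzPhi t hq n) (N := (q - 1) * N) ?_ ?_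
  · rw [map_carlitzPhi, Ideal.Quotient.eq_zero_iff_mem.2 ht, carlitzPhi, hN, map_pow, expand_X,
      pow_mul]
  · rwa [carlitzPhi, coeff_expand (by lia), if_pos (dvd_zero _), Nat.zero_div,
      coeff_zero_carlitzPsi]

theorem carlitzPoly_zero : carlitzPoly q t 0 = X := by
  simp [carlitzPoly, carlitzFactor]

theorem carlitzPoly_succ (hq : q ≠ 0) (j : ℕ) :
    carlitzPoly q t (j + 1) = carlitzPoly q t j ^ q + C t * carlitzPoly q t j := by
  obtain ⟨m, rfl⟩ := Nat.exists_eq_succ_of_ne_zero hq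
  simp only [carlitzPoly, carlitzFactor, map_add, map_mul, expand_X, map_pow, expand_C,
    Nat.succ_eq_add_one, Nat.add_sub_cancel]
  ring

theorem carlitzPhi_eq (n : ℕ) :
    carlitzPhi q t n = carlitzPoly q t n ^ (q - 1) + C t := by
  simp only [carlitzPhi, carlitzPsi, carlitzPoly, map_add, map_mul, expand_X, map_pow, expand_C]
  ring

theorem carlitzPoly_succ_eq_mul (hq : q ≠ 0) (n : ℕ) :
    carlitzPoly q t (n + 1) = carlitzPoly q t n * carlitzPhi q t n := by
  rw [carlitzPoly_succ t hq, carlitzPhi_eq, mul_add, mul_pow_sub_one hq, mul_comm (C t)]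

theorem derivative_carlitzPoly (hq : q ≠ 0) (hR : (q : R) = 0) (j : ℕ) :
    derivative (carlitzPoly q t j) = C (t ^ j) := by
  induction j with
  | zero => simp [carlitzPoly_zero]
  | succ j ih =>
    rw [carlitzPoly_succ t hq, derivative_add, derivative_pow, hR, derivative_C_mul, ih]
    simp [pow_succ, mul_comm]

theorem monic_carlitzPoly (hq : 1 < q) (j : ℕ) : (carlitzPoly q t j).Monic :=
  monic_X.mul ((monic_carlitzFactor t (by lia) j).expand (by lia))

end CarlitzPolynomials

section CarlitzModule

variable {k L : Type*} [Field k] [Fintype k] [Field L] [Algebra k L]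

variable (k) in
/-- The endomorphism `φ(z) = z^q + T z` of an extension field `L` of `k`, where `q = |k|`. Over an
algebraic closure of `k(x)` it is `carlitzEnd`. -/
def carlitzMap (T : L) : Module.End k L :=
  (FiniteField.frobeniusAlgHom k L).toLinearMap + LinearMap.mulLeft k T

theorem carlitzMap_apply (T z : L) : carlitzMap k T z = z ^ Fintype.card k + T * z := rfl

theorem carlitzMap_apply_eq_mul (T z : L) :
    carlitzMap k T z = (z ^ (Fintype.card k - 1) + T) * z := by
  rw [carlitzMap_apply, add_mul, pow_sub_one_mul Fintype.card_ne_zero]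

theorem carlitzMap_pow_apply {R : Type*} [CommRing R] [Algebra R L] (t : R) (j : ℕ) (z : L) :
    (carlitzMap k (algebraMap R L t) ^ j) z = aeval z (carlitzPoly (Fintype.card k) t j) := by
  induction j with
  | zero => simp [carlitzPoly_zero]
  | succ j ih =>
    rw [pow_succ', Module.End.mul_apply, ih, carlitzMap_apply,
      carlitzPoly_succ t Fintype.card_ne_zero]
    simp

theorem finite_setOf_carlitzMap_pow_apply_eq_zero (T : L) (j : ℕ) :
    {z : L | (carlitzMap k T ^ j) z = 0}.Finite := by
  refine ((carlitzPoly (Fintype.card k) T j).rootSet_finite L).subset fun z hz ↦ ?_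
  rw [mem_rootSet, ← carlitzMap_pow_apply]
  exact ⟨(monic_carlitzPoly T Fintype.one_lt_card j).ne_zero, hz⟩

variable (k) in
/-- `x` generates the `T^{n+1}`-torsion as a `k[φ]`-module. For `T ≠ 0` this means that
`φ^{n+1}(x) = 0` and `φ^n(x) ≠ 0`, and as `φ(z) = (z^{q-1} + T) z` it is then equivalent to the
equation used here. -/
def IsCarlitzGenerator (T : L) (n : ℕ) (x : L) : Prop :=
  ((carlitzMap k T ^ n) x) ^ (Fintype.card k - 1) = -T

variable {T : L}

theorem pow_card_sub_one_eq_neg_of_carlitzMap_eq_zero {z : L} (hz : carlitzMap k T z = 0)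
    (hz0 : z ≠ 0) : z ^ (Fintype.card k - 1) = -T := by
  rw [carlitzMap_apply_eq_mul] at hz
  exact eq_neg_of_add_eq_zero_left ((mul_eq_zero.1 hz).resolve_right hz0)

local notation "φ" => carlitzMap k T

variable {n : ℕ} {x y z : L}

theorem aeval_carlitzMap_C_apply (c : k) (z : L) : aeval φ (C c) z = c • z := by
  rw [aeval_C, Module.algebraMap_end_apply]

theorem aeval_carlitzMap_mul_apply (S M : k[X]) (z : L) :
    aeval φ (S * M) z = aeval φ S (aeval φ M z) := by
  rw [map_mul, Module.End.mul_apply]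

theorem isCarlitzGenerator_of_pow_apply_ne_zero (hz : (φ ^ (n + 1)) z = 0)
    (hz0 : (φ ^ n) z ≠ 0) : IsCarlitzGenerator k T n z := by
  rw [pow_succ', Module.End.mul_apply] at hz
  exact pow_card_sub_one_eq_neg_of_carlitzMap_eq_zero hz hz0

theorem aeval_carlitzPhi_eq_zero_iff {R : Type*} [CommRing R] [Algebra R L] {t : R} :
    aeval x (carlitzPhi (Fintype.card k) t n) = 0 ↔
      IsCarlitzGenerator k (algebraMap R L t) n x := by
  rw [carlitzPhi_eq, map_add, map_pow, ← carlitzMap_pow_apply, aeval_C, add_eq_zero_iff_eq_neg,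
    IsCarlitzGenerator]

theorem aeval_derivative_carlitzPhi {R : Type*} [CommRing R] [Algebra R L] {t : R} :
    aeval x (derivative (carlitzPhi (Fintype.card k) t n)) =
      -(aeval (x ^ (Fintype.card k - 1)) (derivative (carlitzPsi (Fintype.card k) t n)) *
        x ^ (Fintype.card k - 2)) := by
  rw [carlitzPhi, derivative_expand, map_mul, expand_aeval, map_mul, map_natCast,
    Nat.cast_sub Fintype.card_pos, natCast_card_eq_zero k]
  simp [Nat.sub_sub]

namespace IsCarlitzGenerator

theorem pow_apply_ne_zero (hx : IsCarlitzGenerator k T n x) (hT : T ≠ 0) : (φ ^ n) x ≠ 0 := by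
  intro h0
  rw [IsCarlitzGenerator, h0, zero_pow card_sub_one_ne_zero] at hx
  exact hT (neg_eq_zero.1 hx.symm)

theorem ne_zero (hx : IsCarlitzGenerator k T n x) (hT : T ≠ 0) : x ≠ 0 := by
  rintro rfl
  exact hx.pow_apply_ne_zero hT (map_zero _)

theorem pow_succ_apply (hx : IsCarlitzGenerator k T n x) : (φ ^ (n + 1)) x = 0 := by
  rw [IsCarlitzGenerator] at hx
  rw [pow_succ', Module.End.mul_apply, carlitzMap_apply_eq_mul, hx, neg_add_cancel, zero_mul]

theorem pow_succ_apply_sub (hx : IsCarlitzGenerator k T n x) (hy : IsCarlitzGenerator k T n y) :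
    (φ ^ (n + 1)) (y - x) = 0 := by
  rw [map_sub, hx.pow_succ_apply, hy.pow_succ_apply, sub_zero]

theorem smul (hx : IsCarlitzGenerator k T n x) {c : k} (hc : c ≠ 0) :
    IsCarlitzGenerator k T n (c • x) := by
  rw [IsCarlitzGenerator] at hx ⊢
  rw [map_smul, smul_pow_card_sub_one hc, hx]

theorem pow_apply_add_pow_apply (hx : IsCarlitzGenerator k T n x) (hn : 1 ≤ n) :
    (φ ^ n) (x + (φ ^ n) x) = (φ ^ n) x := by
  have pow_add_apply : (φ ^ (n + n)) x = 0 := by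
    rw [show n + n = n - 1 + (n + 1) by lia, pow_add, Module.End.mul_apply, hx.pow_succ_apply,
      map_zero]
  rw [map_add, ← Module.End.mul_apply, ← pow_add, pow_add_apply, add_zero]

theorem add_pow_apply (hx : IsCarlitzGenerator k T n x) (hn : 1 ≤ n) :
    IsCarlitzGenerator k T n (x + (φ ^ n) x) := by
  rw [IsCarlitzGenerator, hx.pow_apply_add_pow_apply hn]
  exact hx

theorem exists_eq_smul_of_carlitzMap_eq_zero (hx : IsCarlitzGenerator k T n x) (hz : φ z = 0) :
    ∃ c : k, z = c • (φ ^ n) x := by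
  by_cases hz0 : z = 0
  · exact ⟨0, by rw [hz0, zero_smul]⟩
  · exact exists_eq_smul_of_pow_card_sub_one_eq
      ((pow_card_sub_one_eq_neg_of_carlitzMap_eq_zero hz hz0).trans hx.symm)

theorem exists_pow_apply_eq_smul (hx : IsCarlitzGenerator k T n x)
    (hy : IsCarlitzGenerator k T n y) : ∃ c : k, (φ ^ n) y = c • (φ ^ n) x :=
  exists_eq_smul_of_pow_card_sub_one_eq (hy.trans hx.symm)

theorem exists_aeval_pow_apply_eq (hx : IsCarlitzGenerator k T n x) {i j : ℕ}
    (hij : i + j = n + 1) (hz : (φ ^ j) z = 0) : ∃ M : k[X], aeval φ M ((φ ^ i) x) = z := by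
  induction j generalizing i z with
  | zero => exact ⟨0, by simpa using hz.symm⟩
  | succ j ih =>
    obtain ⟨c, hc⟩ := hx.exists_eq_smul_of_carlitzMap_eq_zero (z := (φ ^ j) z) (by
      rw [← Module.End.mul_apply, ← pow_succ', hz])
    obtain ⟨M, hM⟩ := ih (i := i + 1) (z := z - c • (φ ^ i) x) (by lia) (by
      rw [map_sub, map_smul, ← Module.End.mul_apply, ← pow_add, hc, show j + i = n by lia,
        sub_self])
    rw [pow_succ', Module.End.mul_apply] at hM
    refine ⟨M * X + C c, ?_⟩
    rw [map_add, LinearMap.add_apply, aeval_carlitzMap_mul_apply, aeval_X, hM,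
      aeval_carlitzMap_C_apply, sub_add_cancel]

theorem exists_aeval_eq (hx : IsCarlitzGenerator k T n x) (hz : (φ ^ (n + 1)) z = 0) :
    ∃ M : k[X], aeval φ M x = z := by
  simpa using hx.exists_aeval_pow_apply_eq (zero_add (n + 1)) hz

theorem exists_carlitzMap_eq (hx : IsCarlitzGenerator k T n x) (hz : (φ ^ n) z = 0) :
    ∃ y, φ y = z := by
  obtain ⟨M, hM⟩ := hx.exists_aeval_pow_apply_eq (add_comm 1 n) hz
  refine ⟨aeval φ M x, ?_⟩
  calc φ (aeval φ M x) = aeval φ (X * M) x := by rw [aeval_carlitzMap_mul_apply, aeval_X]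
    _ = aeval φ (M * X) x := by rw [mul_comm]
    _ = z := by rw [aeval_carlitzMap_mul_apply, aeval_X, ← hM, pow_one]

theorem aeval_derivative_carlitzPhi_mul {K : Type*} [Field K] [Algebra k K] [Algebra K L] {T : K}
    (hx : IsCarlitzGenerator k (algebraMap K L T) n x) :
    aeval x (derivative (carlitzPhi (Fintype.card k) T n)) *
      (carlitzMap k (algebraMap K L T) ^ n) x = algebraMap K L T ^ (n + 1) := by
  have derivative_eq := congrArg (fun f ↦ aeval x (derivative f))
    (carlitzPoly_succ_eq_mul T (Fintype.card_ne_zero (α := k)) n)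
  simp only [derivative_carlitzPoly T Fintype.card_ne_zero (natCast_card_eq_zero k),
    derivative_mul, map_add, map_mul, aeval_carlitzPhi_eq_zero_iff.2 hx, aeval_C, map_pow,
    mul_zero, zero_add, ← carlitzMap_pow_apply] at derivative_eq
  rw [mul_comm, derivative_eq]

theorem aeval_derivative_carlitzPsi_mul {K : Type*} [Field K] [Algebra k K] [Algebra K L] {T : K}
    (hx : IsCarlitzGenerator k (algebraMap K L T) n x) :
    aeval (x ^ (Fintype.card k - 1)) (derivative (carlitzPsi (Fintype.card k) T n)) *
      (x ^ (Fintype.card k - 2) * (carlitzMap k (algebraMap K L T) ^ n) x) =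
        -algebraMap K L T ^ (n + 1) := by
  rw [← hx.aeval_derivative_carlitzPhi_mul, aeval_derivative_carlitzPhi]
  ring

end IsCarlitzGenerator

section Valuation

variable {Γ : Type*} [LinearOrderedCommGroupWithZero Γ] (v : Valuation L Γ)

theorem valuation_smul_le {A B : Type*} [CommSemiring A] [Ring B] [Algebra A B]
    (v : Valuation B Γ) [v.IsTrivialOn A] (a : A) (b : B) : v (a • b) ≤ v b := by
  rw [Algebra.smul_def, map_mul]
  exact mul_le_of_le_one_left' (Valuation.IsTrivialOn.valuation_algebraMap_le_one v a)

theorem valuation_carlitzMap_le (hT : v T ≤ 1) (hz : v z ≤ 1) : v (φ z) ≤ v z := by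
  rw [carlitzMap_apply_eq_mul, map_mul]
  refine mul_le_of_le_one_left' ((v.map_add _ _).trans (max_le ?_ hT))
  rw [map_pow]
  exact pow_le_one' hz _

theorem valuation_carlitzMap_pow_le (hT : v T ≤ 1) (hz : v z ≤ 1) (j : ℕ) :
    v ((φ ^ j) z) ≤ v z := by
  induction j with
  | zero => simp
  | succ j ih =>
    rw [pow_succ', Module.End.mul_apply]
    exact (valuation_carlitzMap_le v hT (ih.trans hz)).trans ih

theorem valuation_aeval_carlitzMap_le (hT : v T ≤ 1) (hz : v z ≤ 1) (M : k[X]) :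
    v (aeval φ M z) ≤ v z := by
  induction M using Polynomial.induction_on' with
  | add M N hM hN =>
    rw [map_add, LinearMap.add_apply]
    exact (v.map_add _ _).trans (max_le hM hN)
  | monomial i c =>
    rw [← C_mul_X_pow_eq_monomial, aeval_carlitzMap_mul_apply, aeval_carlitzMap_C_apply,
      aeval_X_pow]
    exact (valuation_smul_le v c _).trans (valuation_carlitzMap_pow_le v hT hz i)

theorem valuation_lt_valuation_carlitzMap (hT : 1 < v T) (hz : z ≠ 0)
    (hne : v z ^ (Fintype.card k - 1) ≠ v T) : v z < v (φ z) := by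
  rw [carlitzMap_apply_eq_mul, map_mul, v.map_add_of_distinct_val (by rwa [map_pow])]
  exact lt_mul_of_one_lt_left (zero_lt_iff.2 ((v.ne_zero_iff).2 hz)) (lt_max_of_lt_right hT)

namespace IsCarlitzGenerator

theorem valuation_pow_apply_pow (hx : IsCarlitzGenerator k T n x) :
    v ((φ ^ n) x) ^ (Fintype.card k - 1) = v T := by
  rw [← map_pow, show _ = -T from hx, Valuation.map_neg]

theorem valuation_pow_apply_lt_one (hx : IsCarlitzGenerator k T n x) (hT : v T < 1) :
    v ((φ ^ n) x) < 1 := by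
  rwa [← hx.valuation_pow_apply_pow v, pow_lt_one_iff card_sub_one_ne_zero] at hT

theorem valuation_pow_apply_eq_one (hx : IsCarlitzGenerator k T n x) (hT : v T = 1) :
    v ((φ ^ n) x) = 1 := by
  rwa [← hx.valuation_pow_apply_pow v, pow_eq_one_iff_of_nonneg zero_le card_sub_one_ne_zero] at hT

theorem valuation_le_one (hx : IsCarlitzGenerator k T n x) (hT : v T ≤ 1) : v x ≤ 1 := by
  have isIntegral : IsIntegral v.integer x :=
    ⟨carlitzPhi (Fintype.card k) ⟨T, hT⟩ n, monic_carlitzPhi _ Fintype.one_lt_card n,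
      aeval_carlitzPhi_eq_zero_iff.2 hx⟩
  exact (Valuation.integer.integers v).mem_of_integral isIntegral

theorem valuation_le (hx : IsCarlitzGenerator k T n x) (hT : v T ≤ 1)
    (hz : (φ ^ (n + 1)) z = 0) : v z ≤ v x := by
  obtain ⟨M, rfl⟩ := hx.exists_aeval_eq hz
  exact valuation_aeval_carlitzMap_le v hT (hx.valuation_le_one v hT) M

theorem valuation_eq (hx : IsCarlitzGenerator k T n x) (hy : IsCarlitzGenerator k T n y)
    (hT : v T ≤ 1) : v y = v x :=
  le_antisymm (hx.valuation_le v hT hy.pow_succ_apply) (hy.valuation_le v hT hx.pow_succ_apply)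

theorem valuation_pow_apply_le (hx : IsCarlitzGenerator k T n x) (hT : v T ≤ 1)
    (hz : (φ ^ (n + 1)) z = 0) (hz0 : z ≠ 0) : v ((φ ^ n) x) ≤ v z := by
  obtain ⟨j, hj, hj_succ⟩ : ∃ j, (φ ^ j) z ≠ 0 ∧ (φ ^ (j + 1)) z = 0 := by
    by_contra! h
    exact Nat.rec (motive := fun j ↦ (φ ^ j) z ≠ 0) hz0 h (n + 1) hz
  obtain ⟨c, hc⟩ := hx.exists_eq_smul_of_carlitzMap_eq_zero (z := (φ ^ j) z) (by
    rw [← Module.End.mul_apply, ← pow_succ', hj_succ])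
  have hc0 : c ≠ 0 := by
    rintro rfl
    exact hj (hc.trans (zero_smul k _))
  calc v ((φ ^ n) x) = v (c⁻¹ • (φ ^ j) z) := by rw [hc, inv_smul_smul₀ hc0]
    _ ≤ v ((φ ^ j) z) := valuation_smul_le v _ _
    _ ≤ v z := valuation_carlitzMap_pow_le v hT
      ((hx.valuation_le v hT hz).trans (hx.valuation_le_one v hT)) j

theorem valuation_eq_one (hx : IsCarlitzGenerator k T n x) (hT : v T = 1) (hz0 : z ≠ 0)
    (hz : (φ ^ (n + 1)) z = 0) : v z = 1 :=
  le_antisymm ((hx.valuation_le v hT.le hz).trans (hx.valuation_le_one v hT.le))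
    ((hx.valuation_pow_apply_eq_one v hT).symm.trans_le (hx.valuation_pow_apply_le v hT.le hz hz0))

theorem valuation_pow_sub_pow (hx : IsCarlitzGenerator k T n x) (hy : IsCarlitzGenerator k T n y)
    (hT0 : T ≠ 0) (hT : v T ≤ 1) {c : k} (hc : (φ ^ n) y = c • (φ ^ n) x) :
    v (y ^ (Fintype.card k - 1) - x ^ (Fintype.card k - 1)) =
      v x ^ (Fintype.card k - 2) * v (y - c • x) := by
  classical
  have valuation_sub_smul : ∀ d ∈ Finset.univ.erase c, v (y - d • x) = v x := fun d hd ↦ by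
    refine hx.valuation_eq v (isCarlitzGenerator_of_pow_apply_ne_zero ?_ ?_) hT
    · rw [map_sub, map_smul, hx.pow_succ_apply, hy.pow_succ_apply, smul_zero, sub_zero]
    · rw [map_sub, map_smul, hc, ← sub_smul]
      exact smul_ne_zero (sub_ne_zero.2 (Finset.ne_of_mem_erase hd).symm)
        (hx.pow_apply_ne_zero hT0)
  have hvx : v x ≠ 0 := v.ne_zero_iff.2 (hx.ne_zero hT0)
  refine mul_left_cancel₀ hvx ?_
  calc v x * v (y ^ (Fintype.card k - 1) - x ^ (Fintype.card k - 1))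
      = ∏ d : k, v (y - d • x) := by
        rw [← map_prod, prod_sub_smul, map_mul, hx.valuation_eq v hy hT]
    _ = v x ^ (Fintype.card k - 1) * v (y - c • x) := by
        rw [← Finset.prod_erase_mul _ _ (Finset.mem_univ c),
          Finset.prod_congr rfl valuation_sub_smul, Finset.prod_const,
          Finset.card_erase_of_mem (Finset.mem_univ c), Finset.card_univ]
    _ = v x * (v x ^ (Fintype.card k - 2) * v (y - c • x)) := by
        rw [← mul_assoc, ← pow_succ',
          show Fintype.card k - 2 + 1 = Fintype.card k - 1 by
            have := Fintype.one_lt_card (α := k); lia]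

theorem le_valuation_pow_sub_pow (hx : IsCarlitzGenerator k T n x)
    (hy : IsCarlitzGenerator k T n y) (hT0 : T ≠ 0) (hT : v T ≤ 1)
    (hne : y ^ (Fintype.card k - 1) ≠ x ^ (Fintype.card k - 1)) :
    v x ^ (Fintype.card k - 2) * v ((φ ^ n) x) ≤
      v (y ^ (Fintype.card k - 1) - x ^ (Fintype.card k - 1)) := by
  obtain ⟨c, hc⟩ := hx.exists_pow_apply_eq_smul hy
  have hc0 : c ≠ 0 := by
    rintro rfl
    exact hy.pow_apply_ne_zero hT0 (hc.trans (zero_smul k _))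
  rw [hx.valuation_pow_sub_pow v hy hT0 hT hc]
  refine mul_le_mul_right (hx.valuation_pow_apply_le v hT ?_ fun h ↦ hne ?_) _
  · rw [map_sub, map_smul, hx.pow_succ_apply, hy.pow_succ_apply, smul_zero, sub_zero]
  · rw [sub_eq_zero.1 h, smul_pow_card_sub_one hc0]

theorem valuation_add_pow_apply_pow_sub_pow (hx : IsCarlitzGenerator k T n x) (hn : 1 ≤ n)
    (hT0 : T ≠ 0) (hT : v T ≤ 1) :
    v ((x + (φ ^ n) x) ^ (Fintype.card k - 1) - x ^ (Fintype.card k - 1)) =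
      v x ^ (Fintype.card k - 2) * v ((φ ^ n) x) := by
  rw [hx.valuation_pow_sub_pow v (hx.add_pow_apply hn) hT0 hT (c := 1)
    (by rw [hx.pow_apply_add_pow_apply hn, one_smul]), one_smul, add_sub_cancel_left]

theorem valuation_pow_sub_pow_eq_one (hx : IsCarlitzGenerator k T n x)
    (hy : IsCarlitzGenerator k T n y) (hT : v T = 1)
    (hne : y ^ (Fintype.card k - 1) ≠ x ^ (Fintype.card k - 1)) :
    v (y ^ (Fintype.card k - 1) - x ^ (Fintype.card k - 1)) = 1 := by
  have hT0 : T ≠ 0 := v.ne_zero_iff.1 (hT.trans_ne one_ne_zero)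
  have hvx := hx.valuation_eq_one v hT (hx.ne_zero hT0) hx.pow_succ_apply
  have hvy := hx.valuation_eq_one v hT (hy.ne_zero hT0) hy.pow_succ_apply
  refine le_antisymm ((v.map_sub _ _).trans (max_le ?_ ?_)) ?_
  · rw [map_pow, hvy, one_pow]
  · rw [map_pow, hvx, one_pow]
  · simpa [hvx, hx.valuation_pow_apply_eq_one v hT] using
      hx.le_valuation_pow_sub_pow v hy hT0 hT.le hne

theorem valuation_aeval_derivative_carlitzPsi_mul {K : Type*} [Field K] [Algebra k K] [Algebra K L]
    {T : K} (hx : IsCarlitzGenerator k (algebraMap K L T) n x) :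
    v (aeval (x ^ (Fintype.card k - 1)) (derivative (carlitzPsi (Fintype.card k) T n))) *
      (v x ^ (Fintype.card k - 2) * v ((carlitzMap k (algebraMap K L T) ^ n) x)) =
        v (algebraMap K L T) ^ (n + 1) := by
  rw [← map_pow, ← map_mul, ← map_mul, hx.aeval_derivative_carlitzPsi_mul, Valuation.map_neg,
    map_pow]

theorem exists_carlitzMap_eq_valuation_lt (hx : IsCarlitzGenerator k T n x) (hT : 1 < v T)
    (hz0 : z ≠ 0) (hz : (φ ^ n) z = 0) : ∃ y, φ y = z ∧ v y < v z := by
  obtain ⟨y, rfl⟩ := hx.exists_carlitzMap_eq hz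
  have hφx : φ ((φ ^ n) x) = 0 := by rw [← Module.End.mul_apply, ← pow_succ', hx.pow_succ_apply]
  have carlitzMap_sub_smul : ∀ c : k, φ (y - c • (φ ^ n) x) = φ y := fun c ↦ by
    rw [map_sub, map_smul, hφx, smul_zero, sub_zero]
  by_cases hall : ∀ c : k, v (y - c • (φ ^ n) x) = v ((φ ^ n) x)
  · refine ⟨y, rfl, ?_⟩
    have carlitzMap_eq_prod : φ y = ∏ c : k, (y - c • (φ ^ n) x) := by
      rw [prod_sub_smul, show _ = -T from hx, sub_neg_eq_add, mul_comm, carlitzMap_apply_eq_mul]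
    have hvy : v y = v ((φ ^ n) x) := by simpa using hall 0
    have hvφy : v (φ y) = v T * v y := by
      rw [carlitzMap_eq_prod, map_prod, Finset.prod_congr rfl fun c _ ↦ hall c, Finset.prod_const,
        Finset.card_univ, hvy, ← hx.valuation_pow_apply_pow v, pow_sub_one_mul Fintype.card_ne_zero]
    have hvy0 : v y ≠ 0 := fun h ↦ hz0 (v.zero_iff.1 (by rw [hvφy, h, mul_zero]))
    exact (lt_mul_of_one_lt_left (zero_lt_iff.2 hvy0) hT).trans_eq hvφy.symm
  · push Not at hall
    obtain ⟨c, hc⟩ := hall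
    have hne : y - c • (φ ^ n) x ≠ 0 := fun h ↦ hz0 (by
      rw [← carlitzMap_sub_smul c, h, map_zero])
    refine ⟨_, carlitzMap_sub_smul c, ?_⟩
    rw [← carlitzMap_sub_smul c]
    refine valuation_lt_valuation_carlitzMap v hT hne ?_
    rw [← hx.valuation_pow_apply_pow v]
    exact fun h ↦ hc ((pow_left_inj₀ zero_le zero_le card_sub_one_ne_zero).1 h)

theorem exists_minimal (hx : IsCarlitzGenerator k T n x) (hT : 1 < v T) :
    ∃ x' : L, IsCarlitzGenerator k T n x' ∧ ∀ z, (φ ^ n) z = 0 → v z ≤ v x' → z = 0 := by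
  have hT0 : T ≠ 0 := v.ne_zero_iff.1 (zero_lt_one.trans hT).ne'
  have hfin : ({z : L | (φ ^ (n + 1)) z = 0} \ {0}).Finite :=
    (finite_setOf_carlitzMap_pow_apply_eq_zero T (n + 1)).subset Set.sdiff_subset
  obtain ⟨x', ⟨hx', hx'0⟩, hmin⟩ :=
    hfin.exists_minimalFor v _ ⟨x, hx.pow_succ_apply, hx.ne_zero hT0⟩
  have eq_zero_of_le : ∀ z, (φ ^ n) z = 0 → v z ≤ v x' → z = 0 := by
    intro z hz hle
    by_contra hz0
    obtain ⟨y, hy, hlt⟩ := hx.exists_carlitzMap_eq_valuation_lt v hT hz0 hz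
    have hy_mem : y ∈ {z : L | (φ ^ (n + 1)) z = 0} \ {0} := by
      refine ⟨?_, fun hy0 ↦ hz0 ?_⟩
      · rw [Set.mem_ofPred_eq, pow_succ, Module.End.mul_apply, hy, hz]
      · rw [← hy, hy0, map_zero]
    exact (hlt.trans_le hle).not_ge (hmin hy_mem (hlt.le.trans hle))
  exact ⟨x', isCarlitzGenerator_of_pow_apply_ne_zero hx' fun h0 ↦
    hx'0 (eq_zero_of_le x' h0 le_rfl), eq_zero_of_le⟩

end IsCarlitzGenerator

end Valuation

end CarlitzModule

section CarlitzExtension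

variable {k K L : Type*} [Field k] [Field K] [Field L] [Algebra k L] [Algebra K L] {x y : L}

theorem galois_smul [Algebra k K] [IsScalarTower k K L] (σ : Gal(L/K)) (c : k) (z : L) :
    σ (c • z) = c • σ z :=
  LinearMap.map_smul_of_tower σ.toLinearMap c z

theorem ne_zero_of_galois_apply_eq_smul (hx0 : x ≠ 0) {σ : Gal(L/K)} {c : k}
    (hc : σ x = c • x) : c ≠ 0 := by
  rintro rfl
  rw [zero_smul] at hc
  exact hx0 ((map_eq_zero_iff _ σ.injective).1 hc)

variable [Fintype k] {T : K} {n : ℕ}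

local notation "φ" => carlitzMap k (algebraMap K L T)

theorem algEquiv_ext_of_adjoin_eq_top (hgen : Algebra.adjoin K {x} = ⊤) {σ τ : Gal(L/K)}
    (h : σ x = τ x) : σ = τ :=
  AlgEquiv.coe_toAlgHom_injective (AlgHom.ext_of_adjoin_eq_top hgen fun _ hz ↦ by
    rwa [Set.mem_singleton_iff.1 hz])

theorem galois_carlitzMap_pow (σ : Gal(L/K)) (j : ℕ) (z : L) :
    σ ((φ ^ j) z) = (φ ^ j) (σ z) := by
  rw [carlitzMap_pow_apply, carlitzMap_pow_apply]
  exact (aeval_algHom_apply σ z _).symm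

theorem IsCarlitzGenerator.galois (hx : IsCarlitzGenerator k (algebraMap K L T) n x)
    (σ : Gal(L/K)) : IsCarlitzGenerator k (algebraMap K L T) n (σ x) := by
  rw [IsCarlitzGenerator] at hx
  rw [IsCarlitzGenerator, ← galois_carlitzMap_pow, ← map_pow, hx, map_neg, AlgEquiv.commutes]

theorem exists_galois_apply_eq [Normal K L]
    (hmin : minpoly K x = carlitzPhi (Fintype.card k) T n)
    (hy : IsCarlitzGenerator k (algebraMap K L T) n y) : ∃ σ : Gal(L/K), σ x = y := by
  refine minpoly.exists_algEquiv_of_root' (Algebra.IsAlgebraic.isAlgebraic x) ?_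
  rw [hmin, aeval_carlitzPhi_eq_zero_iff]
  exact hy

theorem card_eq_card_sub_one_of_mem_iff [Normal K L] (hx0 : x ≠ 0)
    (hx : IsCarlitzGenerator k (algebraMap K L T) n x)
    (hgen : Algebra.adjoin K {x} = ⊤) (hmin : minpoly K x = carlitzPhi (Fintype.card k) T n)
    {H : Subgroup Gal(L/K)} (hH : ∀ σ, σ ∈ H ↔ ∃ c : k, σ x = c • x) :
    Nat.card H = Fintype.card k - 1 := by
  have exists_mem_apply_eq_smul : ∀ c : kˣ, ∃ σ : H, (σ : Gal(L/K)) x = (c : k) • x := fun c ↦ by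
    obtain ⟨σ, hσ⟩ := exists_galois_apply_eq hmin (hx.smul c.ne_zero)
    exact ⟨⟨σ, (hH σ).2 ⟨c, hσ⟩⟩, hσ⟩
  choose f hf using exists_mem_apply_eq_smul
  have f_bijective : Function.Bijective f := by
    refine ⟨fun c d hcd ↦ Units.ext (smul_left_injective k hx0 ?_), fun σ ↦ ?_⟩
    · exact (hf c).symm.trans ((congrArg (fun σ : H ↦ (σ : Gal(L/K)) x) hcd).trans (hf d))
    · obtain ⟨c, hc⟩ := (hH σ).1 σ.2
      exact ⟨Units.mk0 c (ne_zero_of_galois_apply_eq_smul hx0 hc),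
        Subtype.ext (algEquiv_ext_of_adjoin_eq_top hgen ((hf _).trans hc.symm))⟩
  rw [← Nat.card_congr (Equiv.ofBijective f f_bijective), Nat.card_units,
    Nat.card_eq_fintype_card]

variable [Algebra k K] [IsScalarTower k K L]

theorem galois_aeval_carlitzMap (σ : Gal(L/K)) (M : k[X]) (z : L) :
    σ (aeval φ M z) = aeval φ M (σ z) := by
  induction M using Polynomial.induction_on' with
  | add M N hM hN => rw [map_add, LinearMap.add_apply, map_add, hM, hN, LinearMap.add_apply]
  | monomial i c =>
    simp only [← C_mul_X_pow_eq_monomial, aeval_carlitzMap_mul_apply, aeval_carlitzMap_C_apply,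
      aeval_X_pow, galois_smul, galois_carlitzMap_pow]

namespace IsCarlitzGenerator

theorem galois_mul_comm (hx : IsCarlitzGenerator k (algebraMap K L T) n x)
    (hgen : Algebra.adjoin K {x} = ⊤) (σ τ : Gal(L/K)) : σ * τ = τ * σ := by
  obtain ⟨M, hM⟩ := hx.exists_aeval_eq (hx.galois σ).pow_succ_apply
  obtain ⟨N, hN⟩ := hx.exists_aeval_eq (hx.galois τ).pow_succ_apply
  refine algEquiv_ext_of_adjoin_eq_top hgen ?_
  rw [AlgEquiv.mul_apply, AlgEquiv.mul_apply, ← hN, ← hM, galois_aeval_carlitzMap,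
    galois_aeval_carlitzMap, ← hN, ← hM, ← aeval_carlitzMap_mul_apply,
    ← aeval_carlitzMap_mul_apply, mul_comm]

theorem exists_galois_apply_eq_smul {Γ : Type*} [LinearOrderedCommGroupWithZero Γ]
    (v : Valuation L Γ) (hx : IsCarlitzGenerator k (algebraMap K L T) n x)
    (hT : 1 < v (algebraMap K L T)) (σ : Gal(L/K))
    (hσ : ∀ z, (φ ^ (n + 1)) z = 0 → v (σ z) = v z) :
    ∃ c : k, σ x = c • x := by
  obtain ⟨x', hx', hmin⟩ := hx.exists_minimal v hT
  obtain ⟨c, hc⟩ := hx'.exists_pow_apply_eq_smul (hx'.galois σ)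
  have galois_apply_eq : σ x' = c • x' := by
    refine sub_eq_zero.1 (hmin _ ?_ ((v.map_sub _ _).trans (max_le ?_ ?_)))
    · rw [map_sub, map_smul, hc, sub_self]
    · exact (hσ x' hx'.pow_succ_apply).le
    · exact valuation_smul_le v c x'
  obtain ⟨N, rfl⟩ := hx'.exists_aeval_eq hx.pow_succ_apply
  exact ⟨c, by rw [galois_aeval_carlitzMap, galois_apply_eq, map_smul]⟩

end IsCarlitzGenerator

end CarlitzExtension

/-! ### Conductor exponents of cyclotomic extensions -/

theorem natDegree_carlitzPhi_pos {k R : Type*} [Field k] [Fintype k] [CommRing R] [Nontrivial R]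
    (t : R) (n : ℕ) :
    0 < (carlitzPhi (Fintype.card k) t n).natDegree := by
  rw [natDegree_carlitzPhi t Fintype.card_ne_zero n]
  exact Nat.mul_pos (Nat.pow_pos Fintype.card_pos) (Nat.pos_of_ne_zero card_sub_one_ne_zero)

section Uniformizer

variable {A : Type*} [CommRing A] [IsDomain A] [IsDiscreteValuationRing A] {t : A}

theorem uniformizer_ne_zero (ht : IsLocalRing.maximalIdeal A = Ideal.span {t}) : t ≠ 0 :=
  ((IsDiscreteValuationRing.irreducible_iff_uniformizer t).2 ht).ne_zero

theorem uniformizer_notMem_maximalIdeal_sq (ht : IsLocalRing.maximalIdeal A = Ideal.span {t}) :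
    t ∉ IsLocalRing.maximalIdeal A ^ 2 := by
  have hirr := (IsDiscreteValuationRing.irreducible_iff_uniformizer t).2 ht
  rw [ht, Ideal.span_singleton_pow, Ideal.mem_span_singleton]
  nth_rw 2 [← pow_one t]
  rw [pow_dvd_pow_iff hirr.ne_zero hirr.not_isUnit]
  decide

variable {k K L : Type*} [Field k] [Fintype k] [Field K] [Field L] [Algebra k L] [Algebra K L]
  [Algebra A K] [IsFractionRing A K] [Algebra A L] [IsScalarTower A K L] {n : ℕ} {x : L}

theorem minpoly_eq_carlitzPhi (ht : IsLocalRing.maximalIdeal A = Ideal.span {t})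
    (hx : IsCarlitzGenerator k (algebraMap A L t) n x) :
    minpoly K x = carlitzPhi (Fintype.card k) (algebraMap A K t) n := by
  rw [minpoly_eq_map_of_isEisensteinAt (IsLocalRing.maximalIdeal.isMaximal A).isPrime
    (monic_carlitzPhi t Fintype.one_lt_card n)
    (carlitzPhi_isEisensteinAt Fintype.one_lt_card n (IsLocalRing.maximalIdeal.isMaximal A).ne_top
      (ht ▸ Ideal.mem_span_singleton_self t) (uniformizer_notMem_maximalIdeal_sq ht))
    (natDegree_carlitzPhi_pos t n) (aeval_carlitzPhi_eq_zero_iff.2 hx), map_carlitzPhi]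

end Uniformizer

theorem aeval_carlitzPsi_eq_zero {k R F L : Type*} [Field k] [Fintype k] [CommRing R] [Field F]
    [Field L] [Algebra k L] [Algebra R F] [Algebra R L] [Algebra F L] [IsScalarTower R F L]
    {t : R} {n : ℕ} {x : L} {y : F} (hx : IsCarlitzGenerator k (algebraMap R L t) n x)
    (hy : algebraMap F L y = x ^ (Fintype.card k - 1)) :
    aeval y (carlitzPsi (Fintype.card k) t n) = 0 := by
  refine (algebraMap F L).injective ?_
  rw [map_zero, ← aeval_algebraMap_apply, hy, ← expand_aeval]
  exact aeval_carlitzPhi_eq_zero_iff.2 hx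

theorem valuation_galois_inv_sub_inv {k K L Γ : Type*} [Field k] [Finite k] [Field K] [Field L]
    [Algebra k L] [Algebra K L] [LinearOrderedCommGroupWithZero Γ] (v : Valuation L Γ)
    {σ : Gal(L/K)} {c : k} (hc : c ≠ 1) {z : L} (hz : σ z = c • z) : v (σ z⁻¹ - z⁻¹) = v z⁻¹ := by
  have hconst : v (algebraMap k L (c⁻¹ - 1)) = 1 :=
    Valuation.IsTrivialOn.eq_one _ (sub_ne_zero.2 (inv_ne_one.2 hc))
  have hsub : σ z⁻¹ - z⁻¹ = algebraMap k L (c⁻¹ - 1) * z⁻¹ := by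
    rw [map_inv₀, hz, Algebra.smul_def, mul_inv, map_sub, map_inv₀, map_one]
    ring
  rw [hsub, map_mul, hconst, one_mul]

namespace Place

section Criteria

variable {k F E : Type*} [Field k] [Field F] [Field E] [Algebra k F] [Algebra k E] [Algebra F E]
  {P : Place k F} {Q : Place k E} [IsDiscreteValuationRing P.ring] [FiniteDimensional F E]

theorem LiesOver.val_algebraMap_le_one_iff [Algebra.IsSeparable F E] (h : Q.LiesOver P) (a : F) :
    h.val (algebraMap F E a) ≤ 1 ↔ a ∈ P.ring := by
  rw [← h.mem_ring_iff, h.algebraMap_mem_iff]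

theorem LiesOver.val_algebraMap_eq_one [Algebra.IsSeparable F E] (h : Q.LiesOver P) {a : F}
    (ha0 : a ≠ 0) (ha : a ∈ P.ring) (ha' : a⁻¹ ∈ P.ring) : h.val (algebraMap F E a) = 1 := by
  refine le_antisymm ((h.val_algebraMap_le_one_iff a).2 ha) ?_
  rw [← inv_le_one₀ (by simpa [zero_lt_iff] using ha0), ← map_inv₀, ← map_inv₀]
  exact (h.val_algebraMap_le_one_iff a⁻¹).2 ha'

theorem LiesOver.val_algebraMap_uniformizer_lt_one [Algebra.IsSeparable F E] (h : Q.LiesOver P)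
    {t : P.ring} (ht : IsLocalRing.maximalIdeal P.ring = Ideal.span {t}) :
    h.val (algebraMap F E t) < 1 := by
  have he := h.ramIndex_ne_zero
  rw [h.val_algebraMap_uniformizer ht, ← WithZero.exp_zero, WithZero.exp_lt_exp]
  lia

theorem LiesOver.condExponent_eq_of_isEisensteinAt [Algebra.IsSeparable F E] (h : Q.LiesOver P)
    {t : P.ring} (ht : IsLocalRing.maximalIdeal P.ring = Ideal.span {t}) {g : P.ring[X]}
    (hg : g.Monic) (hE : g.IsEisensteinAt (IsLocalRing.maximalIdeal P.ring))
    (hdeg : 0 < g.natDegree) {x : E} (hx : aeval x g = 0) (hgen : Algebra.adjoin F {x} = ⊤)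
    {σ₀ : Gal(E/F)} (hmax : ∀ σ : Gal(E/F), σ ≠ 1 → h.val (σ₀ x - x) ≤ h.val (σ x - x))
    (hlt : h.val (σ₀ x - x) < 1) (N : ℕ)
    (hder : h.val (aeval x (derivative (g.map (algebraMap P.ring F)))) * h.val (σ₀ x - x) =
      h.val (algebraMap F E t) ^ N) : condExponent h = N := by
  rw [← minpoly_eq_map_of_isEisensteinAt (IsLocalRing.maximalIdeal.isMaximal P.ring).isPrime hg hE
    hdeg hx] at hder
  exact h.condExponent_eq_of_adjoin_eq_top (π := ⟨x, g, hg, hx⟩)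
    (adjoin_eq_top_of_isEisensteinAt hg hE hdeg hx hgen) hgen hmax hlt ht N hder

theorem LiesOver.condExponent_eq_zero_of_val_sub_eq_one [IsGalois F E] (h : Q.LiesOver P) {x : E}
    (hx : h.val x ≤ 1) (hsub : ∀ σ : Gal(E/F), σ ≠ 1 → h.val (σ x - x) = 1) :
    condExponent h = 0 := by
  refine h.condExponent_eq_zero fun σ hσ ↦ ?_
  by_contra hσ1
  have hle := (h.mem_ramGroup_iff σ 0).1 hσ x ((h.mem_ring_iff x).2 hx)
  rw [hsub σ hσ1] at hle
  exact absurd hle (by decide)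

theorem LiesOver.condExponent_eq_zero_of_decomp_eq_bot [IsGalois F E] (h : Q.LiesOver P)
    (hbot : ∀ σ ∈ h.decomp, σ = 1) : condExponent h = 0 :=
  h.condExponent_eq_zero fun σ hσ ↦ hbot σ (h.ramGroup_subset_decomp 0 hσ)

end Criteria

section Cyclotomic

variable {k K L : Type*} [Field k] [Fintype k] [Field K] [Field L] [Algebra k K] [Algebra k L]
  [Algebra K L] {T : K} {n : ℕ} {x : L}
  {P : Place k K} {Q : Place k L} [IsDiscreteValuationRing P.ring] [FiniteDimensional K L]
  [IsGalois K L]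

theorem LiesOver.condExponent_cyclotomic_uniformizer (h : Q.LiesOver P) {t : P.ring}
    (ht : IsLocalRing.maximalIdeal P.ring = Ideal.span {t})
    (hx : IsCarlitzGenerator k (algebraMap K L t) n x) (hn : 1 ≤ n)
    (hgen : Algebra.adjoin K {x} = ⊤) : condExponent h = (n + 1 : ℕ) := by
  have hv := h.val_algebraMap_uniformizer_lt_one (E := L) ht
  obtain ⟨σ₀, hσ₀⟩ := exists_galois_apply_eq (minpoly_eq_carlitzPhi ht hx) (hx.add_pow_apply hn)
  have hsub : σ₀ x - x = (carlitzMap k (algebraMap K L t) ^ n) x := by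
    rw [hσ₀, add_sub_cancel_left]
  have hderiv : h.val (aeval x (derivative (carlitzPhi (Fintype.card k) (t : K) n))) *
      h.val (σ₀ x - x) = h.val (algebraMap K L t) ^ (n + 1) := by
    rw [hsub, ← map_mul, hx.aeval_derivative_carlitzPhi_mul, map_pow]
  refine h.condExponent_eq_of_isEisensteinAt ht (monic_carlitzPhi t Fintype.one_lt_card n)
    (carlitzPhi_isEisensteinAt Fintype.one_lt_card n (IsLocalRing.maximalIdeal.isMaximal _).ne_top
      (ht ▸ Ideal.mem_span_singleton_self t) (uniformizer_notMem_maximalIdeal_sq ht))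
    (natDegree_carlitzPhi_pos t n) (aeval_carlitzPhi_eq_zero_iff.2 hx) hgen (σ₀ := σ₀) ?_ ?_ _ ?_
  · intro σ hσ
    rw [hsub]
    exact hx.valuation_pow_apply_le h.val hv.le (hx.pow_succ_apply_sub (hx.galois σ))
      (sub_ne_zero.2 fun hfix ↦ hσ (algEquiv_ext_of_adjoin_eq_top hgen hfix))
  · rw [hsub]
    exact hx.valuation_pow_apply_lt_one h.val hv
  · rwa [map_carlitzPhi]

theorem LiesOver.condExponent_cyclotomic_unit (h : Q.LiesOver P)
    (hx : IsCarlitzGenerator k (algebraMap K L T) n x) (hT0 : T ≠ 0) (hT : T ∈ P.ring)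
    (hT' : T⁻¹ ∈ P.ring) (hgen : Algebra.adjoin K {x} = ⊤) : condExponent h = 0 := by
  have hv : h.val (algebraMap K L T) = 1 := h.val_algebraMap_eq_one hT0 hT hT'
  refine h.condExponent_eq_zero_of_val_sub_eq_one (hx.valuation_le_one h.val hv.le) fun σ hσ ↦ ?_
  exact hx.valuation_eq_one h.val hv
    (sub_ne_zero.2 fun hfix ↦ hσ (algEquiv_ext_of_adjoin_eq_top hgen hfix))
    (hx.pow_succ_apply_sub (hx.galois σ))

variable [IsScalarTower k K L]

theorem LiesOver.exists_apply_eq_smul_of_mem_decomp (h : Q.LiesOver P)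
    (hx : IsCarlitzGenerator k (algebraMap K L T) n x) (hT : T ∉ P.ring) {σ : Gal(L/K)}
    (hσ : σ ∈ h.decomp) : ∃ c : k, σ x = c • x :=
  hx.exists_galois_apply_eq_smul h.val
    (not_le.1 fun hle ↦ hT ((h.val_algebraMap_le_one_iff T).1 hle)) σ
    fun z _ ↦ h.val_apply_of_mem_decomp hσ z

theorem LiesOver.condExponent_cyclotomic_pole_of_card_eq_two (h : Q.LiesOver P)
    (hx : IsCarlitzGenerator k (algebraMap K L T) n x) (hT : T ∉ P.ring)
    (hgen : Algebra.adjoin K {x} = ⊤) (hq : Fintype.card k = 2) : condExponent h = 0 := by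
  have hT0 : T ≠ 0 := fun hzero ↦ hT (hzero ▸ zero_mem _)
  have hx0 : x ≠ 0 := hx.ne_zero (by simpa using hT0)
  refine h.condExponent_eq_zero_of_decomp_eq_bot fun σ hσ ↦
    algEquiv_ext_of_adjoin_eq_top hgen ?_
  obtain ⟨c, hc⟩ := h.exists_apply_eq_smul_of_mem_decomp hx hT hσ
  have hc1 := FiniteField.pow_card_sub_one_eq_one c (ne_zero_of_galois_apply_eq_smul hx0 hc)
  rw [hq, pow_one] at hc1
  rw [hc, hc1, one_smul, AlgEquiv.one_apply]

theorem LiesOver.condExponent_cyclotomic_pole (h : Q.LiesOver P)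
    (hx : IsCarlitzGenerator k (algebraMap K L T) n x) {t : P.ring}
    (ht : IsLocalRing.maximalIdeal P.ring = Ideal.span {t}) (htT : (t : K) = T⁻¹)
    (hT : T ∉ P.ring) (hgen : Algebra.adjoin K {x} = ⊤)
    (hmin : minpoly K x = carlitzPhi (Fintype.card k) T n)
    {H : Subgroup Gal(L/K)} (hH : ∀ σ, σ ∈ H ↔ ∃ c : k, σ x = c • x)
    (hq : 2 < Fintype.card k) : condExponent h = 1 := by
  have hT0 : T ≠ 0 := fun hzero ↦ hT (hzero ▸ zero_mem _)
  have hx0 : x ≠ 0 := hx.ne_zero (by simpa using hT0)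
  have hcard := card_eq_card_sub_one_of_mem_iff hx0 hx hgen hmin hH
  set w := (carlitzMap k (algebraMap K L T) ^ n) x with hw
  obtain ⟨he, hdecomp, hval⟩ := h.ramIndex_eq_card_of_decomp_le (π := w⁻¹)
    (fun σ hσ ↦ (hH σ).2 (h.exists_apply_eq_smul_of_mem_decomp hx hT hσ)) ht (by
      rw [hcard, map_inv₀, inv_pow, hx.valuation_pow_apply_pow, htT, map_inv₀, map_inv₀])
  refine h.condExponent_eq_one (by lia) ?_ hval fun σ hσ hσ1 ↦ ?_
  · rw [hdecomp, hcard, Nat.cast_sub Fintype.card_pos, natCast_card_eq_zero k, Nat.cast_one,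
      zero_sub, Valuation.map_neg, map_one]
  · obtain ⟨c, hc⟩ := h.exists_apply_eq_smul_of_mem_decomp hx hT hσ
    refine valuation_galois_inv_sub_inv h.val (c := c) ?_ ?_
    · rintro rfl
      exact hσ1 (algEquiv_ext_of_adjoin_eq_top hgen (by rw [hc, one_smul, AlgEquiv.one_apply]))
    · rw [hw, galois_carlitzMap_pow, hc, map_smul]

end Cyclotomic

end Place

section Lift

variable {K F L : Type*} [Field K] [Field F] [Field L] [Algebra K F] [Algebra K L] [Algebra F L]
  [IsScalarTower K F L] {x : L} {y : F} {m : ℕ}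

theorem exists_algebraMap_galois_sub_eq [Normal K F] (hy : algebraMap F L y = x ^ m)
    (τ : Gal(L/K)) : ∃ σ : Gal(F/K), algebraMap F L (σ y - y) = τ x ^ m - x ^ m :=
  ⟨τ.restrictNormal F, by rw [map_sub, AlgEquiv.restrictNormal_commutes, hy, map_pow]⟩

variable [Normal K L]

theorem algebraMap_galois_sub (hy : algebraMap F L y = x ^ m) (σ : Gal(F/K)) :
    algebraMap F L (σ y - y) = σ.liftNormal L x ^ m - x ^ m := by
  rw [map_sub, ← AlgEquiv.liftNormal_commutes, hy, map_pow]

theorem liftNormal_apply_pow_ne (hy : algebraMap F L y = x ^ m)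
    (hgen : Algebra.adjoin K {y} = ⊤) {σ : Gal(F/K)} (hσ : σ ≠ 1) :
    σ.liftNormal L x ^ m ≠ x ^ m := by
  intro hfix
  rw [← sub_eq_zero, ← algebraMap_galois_sub hy, map_eq_zero, sub_eq_zero] at hfix
  exact hσ (algEquiv_ext_of_adjoin_eq_top hgen hfix)

end Lift

namespace Place

section FixedField

variable {k K F L : Type*} [Field k] [Fintype k] [Field K] [Field F] [Field L] [Algebra k K]
  [Algebra k F] [Algebra k L] [Algebra K F] [Algebra K L] [Algebra F L] [IsScalarTower K F L]
  [FiniteDimensional K F] [IsGalois K F] [Normal K L] {T : K} {n : ℕ} {x : L} {y : F}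
  {P : Place k K} {Q : Place k F} [IsDiscreteValuationRing P.ring]

theorem LiesOver.condExponent_fixedField_uniformizer (h : Q.LiesOver P) {t : P.ring}
    (ht : IsLocalRing.maximalIdeal P.ring = Ideal.span {t})
    (hx : IsCarlitzGenerator k (algebraMap K L t) n x) (hn : 1 ≤ n)
    (hy : algebraMap F L y = x ^ (Fintype.card k - 1)) (hgen : Algebra.adjoin K {y} = ⊤) :
    condExponent h = (n + 1 : ℕ) := by
  obtain ⟨W, hW⟩ := h.exists_val_isEquiv_comap L
  have ht0 : algebraMap K L t ≠ 0 := by simpa using uniformizer_ne_zero ht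
  have hv : W.valuation (algebraMap K L t) < 1 := by
    rw [IsScalarTower.algebraMap_apply K F L]
    exact hW.lt_one_iff_lt_one.1 (h.val_algebraMap_uniformizer_lt_one ht)
  obtain ⟨τ, hτ⟩ := exists_galois_apply_eq (minpoly_eq_carlitzPhi ht hx) (hx.add_pow_apply hn)
  obtain ⟨σ₀, hσ₀⟩ := exists_algebraMap_galois_sub_eq hy τ
  have hval : W.valuation (algebraMap F L (σ₀ y - y)) = W.valuation x ^ (Fintype.card k - 2) *
      W.valuation ((carlitzMap k (algebraMap K L t) ^ n) x) := by
    rw [hσ₀, hτ, hx.valuation_add_pow_apply_pow_sub_pow W.valuation hn ht0 hv.le]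
  refine h.condExponent_eq_of_isEisensteinAt ht (monic_carlitzPsi t Fintype.card_ne_zero n)
    (carlitzPsi_isEisensteinAt Fintype.card_ne_zero n (IsLocalRing.maximalIdeal.isMaximal _).ne_top
      (ht ▸ Ideal.mem_span_singleton_self t) (uniformizer_notMem_maximalIdeal_sq ht))
    (by rw [natDegree_carlitzPsi t Fintype.card_ne_zero]; exact Nat.pow_pos Fintype.card_pos)
    (aeval_carlitzPsi_eq_zero hx hy) hgen (σ₀ := σ₀) (fun σ hσ ↦ (hW _ _).2 ?_)
    (hW.lt_one_iff_lt_one.2 ?_) _ ?_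
  · rw [Valuation.comap_apply, Valuation.comap_apply, hval, algebraMap_galois_sub hy]
    exact hx.le_valuation_pow_sub_pow W.valuation (hx.galois _) ht0 hv.le
      (liftNormal_apply_pow_ne hy hgen hσ)
  · rw [Valuation.comap_apply, hval]
    exact (mul_le_of_le_one_left' (pow_le_one' (hx.valuation_le_one W.valuation hv.le) _)).trans_lt
      (hx.valuation_pow_apply_lt_one W.valuation hv)
  · rw [map_carlitzPsi, ← map_mul, ← map_pow]
    refine hW.eq_iff.2 ?_
    rw [map_mul, map_pow, Valuation.comap_apply, Valuation.comap_apply, Valuation.comap_apply, hval,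
      ← aeval_algebraMap_apply, hy, ← IsScalarTower.algebraMap_apply]
    exact hx.valuation_aeval_derivative_carlitzPsi_mul W.valuation

theorem LiesOver.condExponent_fixedField_unit (h : Q.LiesOver P)
    (hx : IsCarlitzGenerator k (algebraMap K L T) n x) (hT0 : T ≠ 0) (hT : T ∈ P.ring)
    (hT' : T⁻¹ ∈ P.ring) (hy : algebraMap F L y = x ^ (Fintype.card k - 1))
    (hgen : Algebra.adjoin K {y} = ⊤) : condExponent h = 0 := by
  obtain ⟨W, hW⟩ := h.exists_val_isEquiv_comap L
  have hv : W.valuation (algebraMap K L T) = 1 := by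
    rw [IsScalarTower.algebraMap_apply K F L]
    exact hW.eq_one_iff_eq_one.1 (h.val_algebraMap_eq_one hT0 hT hT')
  refine h.condExponent_eq_zero_of_val_sub_eq_one (x := y) (hW.le_one_iff_le_one.2 ?_)
    fun σ hσ ↦ hW.eq_one_iff_eq_one.2 ?_
  · rw [Valuation.comap_apply, hy, map_pow]
    exact pow_le_one' (hx.valuation_le_one W.valuation hv.le) _
  · rw [Valuation.comap_apply, algebraMap_galois_sub hy]
    exact hx.valuation_pow_sub_pow_eq_one W.valuation (hx.galois _) hv
      (liftNormal_apply_pow_ne hy hgen hσ)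

theorem LiesOver.condExponent_fixedField_pole [IsScalarTower k K L] (h : Q.LiesOver P)
    (hx : IsCarlitzGenerator k (algebraMap K L T) n x) (hT : T ∉ P.ring)
    (hy : algebraMap F L y = x ^ (Fintype.card k - 1)) (hgen : Algebra.adjoin K {y} = ⊤)
    (hF : ∀ z : L, (carlitzMap k (algebraMap K L T) ^ (n + 1)) z = 0 →
      z ^ (Fintype.card k - 1) ∈ Set.range (algebraMap F L)) :
    condExponent h = 0 := by
  have hT0 : T ≠ 0 := fun hzero ↦ hT (hzero ▸ zero_mem _)
  have hx0 : x ≠ 0 := hx.ne_zero (by simpa using hT0)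
  obtain ⟨W, hW⟩ := h.exists_val_isEquiv_comap L
  have hv : 1 < W.valuation (algebraMap K L T) := by
    rw [IsScalarTower.algebraMap_apply K F L]
    refine hW.one_lt_iff_one_lt.1 (not_le.1 fun hle ↦ hT ?_)
    exact (h.val_algebraMap_le_one_iff T).1 hle
  refine h.condExponent_eq_zero_of_decomp_eq_bot fun σ hσ ↦ ?_
  by_contra hσ1
  have hpres : ∀ z : L, (carlitzMap k (algebraMap K L T) ^ (n + 1)) z = 0 →
      W.valuation (σ.liftNormal L z) = W.valuation z := by
    intro z hz
    obtain ⟨w, hw⟩ := hF z hz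
    refine (pow_left_inj₀ zero_le zero_le (card_sub_one_ne_zero (k := k))).1 ?_
    rw [← map_pow, ← map_pow, ← map_pow, ← hw, AlgEquiv.liftNormal_commutes]
    exact hW.eq_iff.1 (h.val_apply_of_mem_decomp hσ w)
  obtain ⟨c, hc⟩ := hx.exists_galois_apply_eq_smul W.valuation hv (σ.liftNormal L) hpres
  refine liftNormal_apply_pow_ne hy hgen hσ1 ?_
  rw [hc, smul_pow_card_sub_one (ne_zero_of_galois_apply_eq_smul hx0 hc)]

end FixedField

end Place

/-! ### The cyclotomic function field over `k(x)` -/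

section CyclotomicFunctionField

theorem adjoin_eq_top_of_le_adjoin_simple {K L : Type*} [Field K] [Field L] [Algebra K L]
    [Algebra.IsAlgebraic K L] (F : IntermediateField K L) (y : F)
    (hF : F ≤ IntermediateField.adjoin K {(y : L)}) : Algebra.adjoin K {y} = ⊤ := by
  rw [← IntermediateField.adjoin_eq_top_iff, eq_top_iff]
  intro z _
  rw [← IntermediateField.mem_lift, IntermediateField.lift_adjoin_simple]
  exact hF z.2

theorem aeval_carlitzMap_mem {k K L : Type*} [Field k] [Fintype k] [Field K] [Field L]
    [Algebra k K] [Algebra k L] [Algebra K L] [IsScalarTower k K L] {T : K}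
    (S : IntermediateField K L) {z : L} (hz : z ∈ S) (M : k[X]) :
    aeval (carlitzMap k (algebraMap K L T)) M z ∈ S := by
  have hφ : ∀ w ∈ S, carlitzMap k (algebraMap K L T) w ∈ S := fun w hw ↦ by
    rw [carlitzMap_apply]
    exact add_mem (pow_mem hw _) (mul_mem (S.algebraMap_mem T) hw)
  have hk : ∀ (c : k), ∀ w ∈ S, c • w ∈ S := fun c w hw ↦ by
    rw [Algebra.smul_def, IsScalarTower.algebraMap_apply k K L]
    exact mul_mem (S.algebraMap_mem _) hw
  induction M using Polynomial.induction_on generalizing z with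
  | C a => exact aeval_carlitzMap_C_apply (k := k) a z ▸ hk a z hz
  | add p r hp hr =>
    rw [map_add, LinearMap.add_apply]
    exact add_mem (hp hz) (hr hz)
  | monomial i a ih =>
    rw [pow_succ, ← mul_assoc, aeval_carlitzMap_mul_apply, aeval_X]
    exact ih (hφ z hz)

theorem separable_carlitzPoly {k K : Type*} [Field k] [Fintype k] [Field K] [Algebra k K] {T : K}
    (hT : T ≠ 0) (j : ℕ) : (carlitzPoly (Fintype.card k) T j).Separable := by
  rw [Polynomial.Separable, derivative_carlitzPoly T Fintype.card_ne_zero (natCast_card_eq_zero k)]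
  exact ⟨0, C (T ^ j)⁻¹, by
    rw [zero_mul, zero_add, ← C_mul, inv_mul_cancel₀ (pow_ne_zero j hT), C_1]⟩

variable {k : Type*} [Field k] [Fintype k] {T : RatFunc k} {n : ℕ}

theorem mem_carlitzTorsion_iff {z : AlgebraicClosure (RatFunc k)} :
    z ∈ carlitzTorsion T (X ^ (n + 1)) ↔
      (carlitzMap k (algebraMap _ (AlgebraicClosure (RatFunc k)) T) ^ (n + 1)) z = 0 := by
  change (aeval (carlitzMap k _) (X ^ (n + 1) : k[X])) z = 0 ↔ _
  rw [map_pow, aeval_X]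

theorem carlitzTorsion_eq_rootSet (T : RatFunc k) (n : ℕ) :
    carlitzTorsion T (X ^ (n + 1)) =
      (carlitzPoly (Fintype.card k) T (n + 1)).rootSet (AlgebraicClosure (RatFunc k)) := by
  ext z
  rw [mem_carlitzTorsion_iff, carlitzMap_pow_apply,
    mem_rootSet_of_ne (monic_carlitzPoly T Fintype.one_lt_card _).ne_zero]

theorem isSplittingField_cyclotomicFunctionField (T : RatFunc k) (n : ℕ) :
    (carlitzPoly (Fintype.card k) T (n + 1)).IsSplittingField (RatFunc k)
      (cyclotomicFunctionField T (X ^ (n + 1))) := by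
  rw [cyclotomicFunctionField, carlitzTorsion_eq_rootSet]
  exact IntermediateField.adjoin_rootSet_isSplittingField (IsAlgClosed.splits _)

instance finiteDimensional_cyclotomicFunctionField (T : RatFunc k) (n : ℕ) :
    FiniteDimensional (RatFunc k) (cyclotomicFunctionField T (X ^ (n + 1))) :=
  have := isSplittingField_cyclotomicFunctionField T n
  Polynomial.IsSplittingField.finiteDimensional _ (carlitzPoly (Fintype.card k) T (n + 1))

theorem isGalois_cyclotomicFunctionField (hT : T ≠ 0) (n : ℕ) :
    IsGalois (RatFunc k) (cyclotomicFunctionField T (X ^ (n + 1))) :=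
  have := isSplittingField_cyclotomicFunctionField T n
  IsGalois.of_separable_splitting_field (p := carlitzPoly (Fintype.card k) T (n + 1))
    (separable_carlitzPoly hT _)

variable (T n) in
theorem exists_isCarlitzGenerator :
    ∃ x : cyclotomicFunctionField T (X ^ (n + 1)),
      IsCarlitzGenerator k (algebraMap _ (cyclotomicFunctionField T (X ^ (n + 1))) T) n x ∧
        Algebra.adjoin (RatFunc k) {x} = ⊤ := by
  obtain ⟨z, hz⟩ := IsAlgClosed.exists_aeval_eq_zero (AlgebraicClosure (RatFunc k))
    (carlitzPhi (Fintype.card k) T n)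
    (natDegree_pos_iff_degree_pos.1 (natDegree_carlitzPhi_pos T n)).ne'
  have hgen := aeval_carlitzPhi_eq_zero_iff.1 hz
  have hmem : z ∈ cyclotomicFunctionField T (X ^ (n + 1)) :=
    IntermediateField.subset_adjoin _ _ (mem_carlitzTorsion_iff.2 hgen.pow_succ_apply)
  let x : cyclotomicFunctionField T (X ^ (n + 1)) := ⟨z, hmem⟩
  refine ⟨x, aeval_carlitzPhi_eq_zero_iff.1 (Subtype.val_injective ?_), ?_⟩
  · exact (aeval_algebraMap_apply (AlgebraicClosure (RatFunc k)) x _).symm.trans hz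
  · refine adjoin_eq_top_of_le_adjoin_simple _ _ (IntermediateField.adjoin_le_iff.2 fun w hw ↦ ?_)
    obtain ⟨M, rfl⟩ := hgen.exists_aeval_eq (mem_carlitzTorsion_iff.1 hw)
    exact aeval_carlitzMap_mem _ (IntermediateField.mem_adjoin_simple_self _ _) M

theorem coe_mem_carlitzTorsion_iff {z : cyclotomicFunctionField T (X ^ (n + 1))} :
    (z : AlgebraicClosure (RatFunc k)) ∈ carlitzTorsion T (X ^ (n + 1)) ↔
      (carlitzMap k (algebraMap _ (cyclotomicFunctionField T (X ^ (n + 1))) T) ^ (n + 1)) z =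
        0 := by
  rw [mem_carlitzTorsion_iff, carlitzMap_pow_apply, carlitzMap_pow_apply, ← Subtype.val_inj]
  exact (congrArg (· = 0) (aeval_algebraMap_apply (AlgebraicClosure (RatFunc k)) z _)).to_iff

variable {x : cyclotomicFunctionField T (X ^ (n + 1))}

theorem mem_constUnits_iff (hT : T ≠ 0)
    (hx : IsCarlitzGenerator k (algebraMap _ (cyclotomicFunctionField T (X ^ (n + 1))) T) n x)
    (σ : Gal(cyclotomicFunctionField T (X ^ (n + 1))/RatFunc k)) :
    σ ∈ constUnits T (X ^ (n + 1)) ↔ ∃ c : k, σ x = c • x := by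
  constructor
  · rintro ⟨a, ha⟩
    exact ⟨a, ha x (coe_mem_carlitzTorsion_iff.2 hx.pow_succ_apply)⟩
  · rintro ⟨c, hc⟩
    have hc0 := ne_zero_of_galois_apply_eq_smul (hx.ne_zero (by simpa using hT)) hc
    refine ⟨Units.mk0 c hc0, fun z hz ↦ ?_⟩
    obtain ⟨M, rfl⟩ := hx.exists_aeval_eq (coe_mem_carlitzTorsion_iff.1 hz)
    rw [galois_aeval_carlitzMap, hc, map_smul, Units.val_mk0]

theorem pow_mem_constUnitsFixedField {z : cyclotomicFunctionField T (X ^ (n + 1))}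
    (hz : (carlitzMap k (algebraMap _ (cyclotomicFunctionField T (X ^ (n + 1))) T) ^ (n + 1)) z =
      0) : z ^ (Fintype.card k - 1) ∈ constUnitsFixedField T (X ^ (n + 1)) := by
  rw [IntermediateField.mem_fixedField_iff]
  rintro σ ⟨a, ha⟩
  rw [map_pow, ha z (coe_mem_carlitzTorsion_iff.2 hz)]
  exact smul_pow_card_sub_one a.ne_zero z

theorem constUnitsFixedField_le (hT : T ≠ 0)
    (hx : IsCarlitzGenerator k (algebraMap _ (cyclotomicFunctionField T (X ^ (n + 1))) T) n x) :
    constUnitsFixedField T (X ^ (n + 1)) ≤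
      IntermediateField.adjoin (RatFunc k) {x ^ (Fintype.card k - 1)} := by
  have := isGalois_cyclotomicFunctionField hT n
  rw [← IsGalois.fixedField_fixingSubgroup
    (IntermediateField.adjoin (RatFunc k) {x ^ (Fintype.card k - 1)})]
  refine IntermediateField.fixedField_antitone fun σ hσ ↦ ?_
  have hfix : σ (x ^ (Fintype.card k - 1)) = x ^ (Fintype.card k - 1) :=
    (IntermediateField.mem_fixingSubgroup_iff _ σ).1 hσ _
      (IntermediateField.mem_adjoin_simple_self _ _)
  rw [mem_constUnits_iff hT hx]
  exact exists_eq_smul_of_pow_card_sub_one_eq (by rw [← map_pow]; exact hfix)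

theorem isAbelianGalois_cyclotomicFunctionField (hT : T ≠ 0) (n : ℕ) :
    IsAbelianGalois (RatFunc k) (cyclotomicFunctionField T (X ^ (n + 1))) := by
  obtain ⟨x, hx, hgen⟩ := exists_isCarlitzGenerator T n
  exact { isGalois_cyclotomicFunctionField hT n with
    is_comm.comm := hx.galois_mul_comm hgen }

end CyclotomicFunctionField

section Conductor

variable {k : Type*} [Field k]

theorem ratFunc_inv_X_sub_C_ne_zero (α : k) : (RatFunc.X - RatFunc.C α : RatFunc k)⁻¹ ≠ 0 :=
  inv_ne_zero (ratFunc_X_sub_C_ne_zero α)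

theorem inv_X_sub_C_mem_placeInfty (α : k) :
    (RatFunc.X - RatFunc.C α)⁻¹ ∈ (placeInfty k).ring :=
  ((placeInfty k).ring.mem_or_inv_mem _).resolve_left (placeInfty_X_sub_C_notMem α)

theorem X_sub_C_mem_of_ne_placeInfty (α : k) {P : Place k (RatFunc k)} (hP : P ≠ placeInfty k) :
    RatFunc.X - RatFunc.C α ∈ P.ring :=
  by_contra fun h ↦ hP (eq_placeInfty h)

variable [Fintype k] {α : k} {n : ℕ} {P : Place k (RatFunc k)}

section CyclotomicK

variable {Q : Place k (cyclotomicK α n)}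

theorem condExponent_cyclotomicK_placeInfty (hn : 1 ≤ n) (h : Q.LiesOver (placeInfty k)) :
    Place.condExponent h = (n + 1 : ℕ) := by
  have isGalois := isGalois_cyclotomicFunctionField (ratFunc_inv_X_sub_C_ne_zero α) n
  obtain ⟨x, hx, hgen⟩ := exists_isCarlitzGenerator (RatFunc.X - RatFunc.C α)⁻¹ n
  exact h.condExponent_cyclotomic_uniformizer (t := ⟨_, inv_X_sub_C_mem_placeInfty α⟩)
    (maximalIdeal_placeInfty rfl) hx hn hgen

theorem condExponent_cyclotomicK_placeZero (h : Q.LiesOver (placeZero α)) :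
    Place.condExponent h = (min 1 ((Fintype.card k : ℤ) - 2) : ℤ) := by
  have hT := ratFunc_inv_X_sub_C_ne_zero α
  have isGalois := isGalois_cyclotomicFunctionField hT n
  have pole := placeZero_X_sub_C_inv_notMem α
  obtain ⟨x, hx, hgen⟩ := exists_isCarlitzGenerator (RatFunc.X - RatFunc.C α)⁻¹ n
  obtain hq | hq : Fintype.card k = 2 ∨ 2 < Fintype.card k := by
    have := Fintype.one_lt_card (α := k)
    lia
  · rw [h.condExponent_cyclotomic_pole_of_card_eq_two hx pole hgen hq, hq]
    simp
  · have hmin := minpoly_eq_carlitzPhi (K := RatFunc k)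
      (maximalIdeal_placeInfty (t := ⟨_, inv_X_sub_C_mem_placeInfty α⟩) rfl) hx
    rw [min_eq_left (by lia), Int.cast_one]
    exact h.condExponent_cyclotomic_pole hx
      (maximalIdeal_placeZero (t := ⟨_, X_sub_C_mem_of_ne_placeInfty α
        (placeInfty_ne_placeZero α).symm⟩) rfl)
      (inv_inv _).symm pole hgen hmin (mem_constUnits_iff hT hx) hq

theorem condExponent_cyclotomicK_of_ne (hPinf : P ≠ placeInfty k) (hPzero : P ≠ placeZero α)
    (h : Q.LiesOver P) : Place.condExponent h = 0 := by
  have hT := ratFunc_inv_X_sub_C_ne_zero α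
  have isGalois := isGalois_cyclotomicFunctionField hT n
  obtain ⟨x, hx, hgen⟩ := exists_isCarlitzGenerator (RatFunc.X - RatFunc.C α)⁻¹ n
  refine h.condExponent_cyclotomic_unit hx hT ?_ ?_ hgen
  · exact by_contra fun hmem ↦ hPzero (eq_placeZero hmem)
  · rw [inv_inv]
    exact X_sub_C_mem_of_ne_placeInfty α hPinf

variable (α) in
theorem isConductor_cyclotomicK (hn : 1 ≤ n) : IsConductor k (RatFunc k) (cyclotomicK α n)
    (Finsupp.single (placeInfty k) ((n : ℤ) + 1) +
      Finsupp.single (placeZero α) (min 1 ((Fintype.card k : ℤ) - 2))) := by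
  have isAbelianGalois := isAbelianGalois_cyclotomicFunctionField (ratFunc_inv_X_sub_C_ne_zero α) n
  refine ⟨inferInstance, isAbelianGalois, Place.exists_liesOver, fun P Q h ↦ ?_⟩
  rw [Finsupp.add_apply]
  obtain rfl | hPinf := eq_or_ne P (placeInfty k)
  · rw [Finsupp.single_eq_same, Finsupp.single_eq_of_ne (placeInfty_ne_placeZero α), add_zero,
      condExponent_cyclotomicK_placeInfty hn]
    simp
  obtain rfl | hPzero := eq_or_ne P (placeZero α)
  · rw [Finsupp.single_eq_of_ne hPinf, zero_add, Finsupp.single_eq_same,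
      condExponent_cyclotomicK_placeZero]
  · rw [Finsupp.single_eq_of_ne hPinf, Finsupp.single_eq_of_ne hPzero, add_zero, Int.cast_zero,
      condExponent_cyclotomicK_of_ne hPinf hPzero]

end CyclotomicK

section CyclotomicF

theorem exists_generator_cyclotomicF (α : k) (n : ℕ) :
    ∃ (x : cyclotomicK α n) (y : cyclotomicF α n),
      IsCarlitzGenerator k (algebraMap _ (cyclotomicK α n) (RatFunc.X - RatFunc.C α)⁻¹) n x ∧
        algebraMap _ (cyclotomicK α n) y = x ^ (Fintype.card k - 1) ∧
          Algebra.adjoin (RatFunc k) {y} = ⊤ := by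
  obtain ⟨x, hx, -⟩ := exists_isCarlitzGenerator (RatFunc.X - RatFunc.C α)⁻¹ n
  exact ⟨x, ⟨_, pow_mem_constUnitsFixedField hx.pow_succ_apply⟩, hx, rfl,
    adjoin_eq_top_of_le_adjoin_simple _ _
      (constUnitsFixedField_le (ratFunc_inv_X_sub_C_ne_zero α) hx)⟩

variable {Q : Place k (cyclotomicF α n)}

theorem condExponent_cyclotomicF_placeInfty (hn : 1 ≤ n) (h : Q.LiesOver (placeInfty k)) :
    Place.condExponent h = (n + 1 : ℕ) := by
  have isAbelianGalois := isAbelianGalois_cyclotomicFunctionField (ratFunc_inv_X_sub_C_ne_zero α) n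
  obtain ⟨x, y, hx, hy, hgen⟩ := exists_generator_cyclotomicF α n
  exact h.condExponent_fixedField_uniformizer (t := ⟨_, inv_X_sub_C_mem_placeInfty α⟩)
    (maximalIdeal_placeInfty rfl) hx hn hy hgen

theorem condExponent_cyclotomicF_of_ne (hPinf : P ≠ placeInfty k) (h : Q.LiesOver P) :
    Place.condExponent h = 0 := by
  have hT := ratFunc_inv_X_sub_C_ne_zero α
  have isAbelianGalois := isAbelianGalois_cyclotomicFunctionField hT n
  obtain ⟨x, y, hx, hy, hgen⟩ := exists_generator_cyclotomicF α n
  by_cases hmem : (RatFunc.X - RatFunc.C α)⁻¹ ∈ P.ring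
  · refine h.condExponent_fixedField_unit hx hT hmem ?_ hy hgen
    rw [inv_inv]
    exact X_sub_C_mem_of_ne_placeInfty α hPinf
  · exact h.condExponent_fixedField_pole hx hmem hy hgen
      fun z hz ↦ ⟨⟨_, pow_mem_constUnitsFixedField hz⟩, rfl⟩

variable (α) in
theorem isConductor_cyclotomicF (hn : 1 ≤ n) : IsConductor k (RatFunc k) (cyclotomicF α n)
    (Finsupp.single (placeInfty k) ((n : ℤ) + 1)) := by
  have isAbelianGalois := isAbelianGalois_cyclotomicFunctionField (ratFunc_inv_X_sub_C_ne_zero α) n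
  refine ⟨inferInstance, inferInstance, Place.exists_liesOver, fun P Q h ↦ ?_⟩
  obtain rfl | hPinf := eq_or_ne P (placeInfty k)
  · rw [Finsupp.single_eq_same, condExponent_cyclotomicF_placeInfty hn]
    simp
  · rw [Finsupp.single_eq_of_ne hPinf, Int.cast_zero, condExponent_cyclotomicF_of_ne hPinf]

end CyclotomicF

end Conductor

end

theorem proposition3p4 {k : Type*} [Field k] [Fintype k] (α : k) (n : ℕ) (hn : 1 ≤ n) :
    IsConductor k (RatFunc k) (cyclotomicK α n)
        (Finsupp.single (placeInfty k) ((n : ℤ) + 1) +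
          Finsupp.single (placeZero α) (min 1 ((Fintype.card k : ℤ) - 2))) ∧
      IsConductor k (RatFunc k) (cyclotomicF α n)
        (Finsupp.single (placeInfty k) ((n : ℤ) + 1)) :=
  ⟨isConductor_cyclotomicK α hn, isConductor_cyclotomicF α hn⟩
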